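/- **Setting.** Graphs are in the sense of Serre: a set $V_X$ of vertices, a set $\mathbf E_X$ of directed edges with origin and terminus maps $o,t$, and a fixed-point-free involution $e\mapsto\bar e$ exchanging origin and terminus (loops and multiple edges are allowed). Put $\chi(X)=|V_X|-|\mathbf E_X|/2$, let $\kappa(X)$ be the number of spanning trees of $X$, and $\mathbb N=\{1,2,\dots\}$. Let $X$ be a finite connected graph with $\chi(X)\neq 0$, and let $\alpha:\mathbf E_X\to\mathbb Z$ satisfy $\alpha(\bar e)=-\alpha(e)$. For $n\ge 1$ let $X_n$ be the graph with vertices $V_X\times\mathbb Z/n$, edges $\mathbf E_X\times\mathbb Z/n$, $o(e,\sigma)=(o(e),\sigma)$, $t(e,\sigma)=(t(e),\sigma+\alpha(e))$, $\overline{(e,\sigma)}=(\bar e,\sigma+\alpha(e))$. Assume that $X_n$ is connected for every $n\ge1$. Let $D_X$ be the diagonal valency matrix, let $A_\alpha(t)$ be the matrix with entries $\sum_{o(e)=v,\,t(e)=w}t^{\alpha(e)}$, and put $$\mathcal I_\alpha=\det(D_X-A_\alpha(t))\in\mathbb Z[t^{\pm1}],\quad b=-\mathrm{ord}_{t=0}\mathcal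 I_\alpha,\quad e=\mathrm{ord}_{t=1}\mathcal I_\alpha,\quad J_\alpha=t^b(t-1)^{-e}\mathcal I_\alpha\in\mathbb Z[t].$$ Fix a prime $p$. Let $\mu_p=-\log M_p(t^b\mathcal I_\alpha)/\log p$, where $M_p(g)=|b_d|_p\prod_i\max\{1,|\gamma_i|_p\}$ for $g=b_d\prod_{i=1}^d(t-\gamma_i)\in\mathbb C_p[t]$ (the $p$-adic Mahler measure). Let $\beta_1,\dots,\beta_d\in\overline{\mathbb Q}_p$ be the roots of $J_\alpha$ with $|\beta_j|_p=1$, listed with multiplicity. Let $N_j$ be the multiplicative order of the reduction of $\beta_j$ in $\overline{\mathbb F}_p^\times$, let $\tau_j$ be the Teichmüller lift of that reduction (the root of unity of order prime to $p$ with the same reduction as $\beta_j$), and let $s_j=\min\{s\ge0:\ p^s(p-1)\,\mathrm{ord}_p(\beta_j-\tau_j)>1\}$. Let $\Delta_1(J_\alpha)=\mathrm{Res}(J_\alpha,t-1)$. **Theorem.** There exist a finite set $\mathcal N_p\subset\mathbb N$ of integers prime to $p$, an integer $R_p\ge0$, integers $\lambda_p(\mathfrak n)\ge0$ for all $\mathfrak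 n\subseteq\mathcal N_p$, and integers $\nu_p(\mathfrak n,r)$ for all $\mathfrak n\subseteq\mathcal N_p$ and $0\le r\le R_p$, such that $$\mathrm{ord}_p\,\kappa(X_n)=\mu_p\cdot n+\lambda_p(\mathfrak n)\cdot\mathrm{ord}_p(n)+\nu_p(\mathfrak n,r)\qquad\text{for all } n\in\mathcal S_p(\mathfrak n,r).$$ Here $\mathcal S_p(\mathfrak n,r)$ is the set of all $n\in\mathbb N$ such that $N\mid n$ for each $N\in\mathfrak n$, $N'\nmid n$ for each $N'\in\mathcal N_p\setminus\mathfrak n$, and $\mathrm{ord}_p(n)=r$ if $r<R_p$, $\mathrm{ord}_p(n)\ge R_p$ if $r=R_p$. Every $n\in\mathbb N$ lies in exactly one of these classes. Explicitly, all this holds with $$\mathcal N_p=\{N_1,\dots,N_d\},\qquad R_p=\max_j s_j\ (\text{and }R_p=0\text{ if }d=0),\qquad \lambda_p(\mathfrak n)=\#\{j: N_j\in\mathfrak n\}+e-1,$$ $$\nu_p(\mathfrak n,r)=\mathrm{ord}_p\,\kappa(X)-\mathrm{ord}_p\,\Delta_1(J_\alpha)+\sum_{j:\,N_j\in\mathfrak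 n}\Bigl(\mathrm{ord}_p\bigl(\beta_j^{p^{m_j}}-\tau_j^{p^{m_j}}\bigr)-m_j\Bigr),\qquad m_j=\min(r,s_j).$$ -/

import Mathlib

open scoped LaurentPolynomial Polynomial

noncomputable section

/-- A graph in the sense of Serre, with vertices `V` and directed edges `E`: origin and terminus
maps and a fixed-point-free involution `inv` (written `e ↦ ē`) exchanging origin and terminus.
Loops and multiple edges are allowed. -/
structure SerreGraph (V : Type*) (E : Type*) where
  o : E → V
  t : E → V
  inv : E → E
  o_inv : ∀ e, o (inv e) = t e
  t_inv : ∀ e, t (inv e) = o e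
  inv_inv : ∀ e, inv (inv e) = e
  inv_ne : ∀ e, inv e ≠ e

namespace SerreGraph

variable {V E : Type*}

/-- Any two vertices are joined by a path, that is, by a finite sequence of directed edges, each
starting where the previous one ends. -/
def Connected (X : SerreGraph V E) : Prop :=
  ∀ v w : V, Relation.ReflTransGen (fun a b => ∃ e, X.o e = a ∧ X.t e = b) v w

/-- The Euler characteristic `|V| - |E| / 2` (`E` consists of directed edges). -/
def eulerChar (_X : SerreGraph V E) [Fintype V] [Fintype E] : ℚ :=
  (Fintype.card V : ℚ) - (Fintype.card E : ℚ) / 2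

/-- A set `T` of directed edges is (the edge set of) a spanning tree: it is stable under inversion,
has no loops and no multiple edges, and the resulting simple graph on all the vertices is a tree. -/
structure IsSpanningTree (X : SerreGraph V E) (T : Set E) : Prop where
  inv_mem : ∀ e ∈ T, X.inv e ∈ T
  no_loop : ∀ e ∈ T, X.o e ≠ X.t e
  no_multiple : ∀ e ∈ T, ∀ f ∈ T, X.o e = X.o f → X.t e = X.t f → e = f
  isTree : (SimpleGraph.fromRel (fun v w => ∃ e ∈ T, X.o e = v ∧ X.t e = w)).IsTree

/-- The number `κ(X)` of spanning trees. -/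
def kappa (X : SerreGraph V E) : ℕ := Nat.card {T : Set E // X.IsSpanningTree T}

/-- A voltage assignment with values in an additively written group. -/
structure Voltage (X : SerreGraph V E) (G : Type*) [AddGroup G] where
  val : E → G
  val_inv : ∀ e, val (X.inv e) = - val e

/-- The voltage assignment `f ∘ α`. -/
def Voltage.map {X : SerreGraph V E} {G H : Type*} [AddGroup G] [AddGroup H]
    (α : X.Voltage G) (f : G →+ H) : X.Voltage H where
  val e := f (α.val e)
  val_inv e := by rw [α.val_inv, map_neg]

/-- The derived graph `X(G, α)`. -/
def derived (X : SerreGraph V E) {G : Type*} [AddGroup G] (α : X.Voltage G) :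
    SerreGraph (V × G) (E × G) where
  o e := (X.o e.1, e.2)
  t e := (X.t e.1, e.2 + α.val e.1)
  inv e := (X.inv e.1, e.2 + α.val e.1)
  o_inv e := by simp [X.o_inv]
  t_inv e := by simp [X.t_inv, α.val_inv]
  inv_inv e := by simp [X.inv_inv, α.val_inv]
  inv_ne e h := X.inv_ne e.1 (congrArg Prod.fst h)

/-- The `n`-th layer `X_n = X(ℤ/nℤ, α_n)` of the tower given by `α`, where `α_n` is `α` modulo `n`
(used only for `n ≥ 1`). -/
def layer (X : SerreGraph V E) (α : X.Voltage ℤ) (n : ℕ) : SerreGraph (V × ZMod n) (E × ZMod n) :=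
  X.derived (α.map (Int.castAddHom (ZMod n)))

/-- The Ihara polynomial `det (D_X - A_α(t)) ∈ ℤ[t, t⁻¹]`, with `D_X` the valency matrix and
`A_α(t)` the matrix whose `(v, w)` entry is the sum of `t ^ α(e)` over the directed edges `e` from
`v` to `w`. -/
def iharaPoly (X : SerreGraph V E) [Fintype V] [DecidableEq V] [Fintype E] (α : X.Voltage ℤ) :
    ℤ[T;T⁻¹] :=
  Matrix.det (Matrix.diagonal
      (fun v => ((Finset.univ.filter (fun e : E => X.o e = v)).card : ℤ[T;T⁻¹])) -
    Matrix.of (fun v w => ∑ e ∈ Finset.univ.filter (fun e : E => X.o e = v ∧ X.t e = w),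
      LaurentPolynomial.T (α.val e)))

end SerreGraph

namespace IharaTower

/-! ### From a Laurent polynomial `F` to the polynomials `I` and `J` -/

/-- The order of vanishing of a nonzero Laurent polynomial at `t = 0`. -/
def ordZero (F : ℤ[T;T⁻¹]) : ℤ := F.coeff.support.min.untopD 0

/-- `I = t ^ b F ∈ ℤ[t]`, where `b = - ord_{t = 0} F`. -/
def clearedPoly (F : ℤ[T;T⁻¹]) : ℤ[X] :=
  LaurentPolynomial.trunc (LaurentPolynomial.T (-ordZero F) * F)

/-- `e = ord_{t = 1} F`. -/
def ordOne (F : ℤ[T;T⁻¹]) : ℕ := (clearedPoly F).rootMultiplicity 1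

/-- `J = t ^ b (t - 1) ^ (-e) F ∈ ℤ[t]`. -/
def jPoly (F : ℤ[T;T⁻¹]) : ℤ[X] :=
  clearedPoly F /ₘ (Polynomial.X - Polynomial.C 1) ^ ordOne F

/-- The Pierce-Lehmer sequence `Δ_n(f) = Res(f, t ^ n - 1)`. -/
def pierceLehmer (f : ℤ[X]) (n : ℕ) : ℤ := f.resultant (Polynomial.X ^ n - 1)

/-! ### `p`-adic quantities -/

variable (p : ℕ) [Fact p.Prime]

/-- The `p`-adic Mahler measure of a polynomial over `ℂ_p`. -/
def padicMahler (g : (ℂ_[p])[X]) : ℝ :=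
  ‖g.leadingCoeff‖ * (g.roots.map (fun β => max 1 ‖β‖)).prod

/-- `- m_p(F) / log p`, with `m_p(F)` the logarithmic `p`-adic Mahler measure of the Laurent
polynomial `F`; as the Mahler measure is multiplicative and equal to `1` at `t`, it is computed
after multiplying `F` by a power of `t`. -/
def muInv (F : ℤ[T;T⁻¹]) : ℝ :=
  - Real.log (padicMahler p ((clearedPoly F).map (Int.castRingHom ℂ_[p]))) / Real.log p

/-- The valuation `ord_p` on (the nonzero elements of) the algebraic closure of `ℚ_p`, with
`ord_p p = 1`. -/
def ordP (x : PadicAlgCl p) : ℝ := - Real.log ‖x‖ / Real.log p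

/-- The ring of integers of the algebraic closure of `ℚ_p`. -/
abbrev algClInt : ValuationSubring (PadicAlgCl p) := (PadicAlgCl.valued p).v.valuationSubring

open Classical in
/-- The reduction of an integral element modulo the maximal ideal (`0` on nonintegral elements). -/
def reduction (β : PadicAlgCl p) : IsLocalRing.ResidueField (algClInt p) :=
  if h : β ∈ algClInt p then IsLocalRing.residue (algClInt p) ⟨β, h⟩ else 0

open Classical in
/-- The Teichmüller lift of an element `x` of the residue field: for `x ≠ 0` it is the unique root
of unity of order prime to `p` whose reduction is `x`, and for `x = 0` it is `0`. -/
def teichmuller (x : IsLocalRing.ResidueField (algClInt p)) : PadicAlgCl p :=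
  if h : ∃ ξ : PadicAlgCl p, (∃ k : ℕ, k.Coprime p ∧ ξ ^ k = 1) ∧ reduction p ξ = x
  then h.choose else 0

/-- The multiplicative order `N(β)` of the reduction of `β`. -/
def residueOrder (β : PadicAlgCl p) : ℕ := orderOf (reduction p β)

/-- `s_p(β) = min {s ≥ 0 : p ^ s (p - 1) ord_p(β - τ(π(β))) > 1}`. -/
def sInv (β : PadicAlgCl p) : ℕ :=
  sInf {s : ℕ | 1 < (p : ℝ) ^ s * ((p : ℝ) - 1) * ordP p (β - teichmuller p (reduction p β))}

open Classical in
/-- The roots of `f` in the algebraic closure of `ℚ_p` lying on the unit circle, counted with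
multiplicity. -/
def unitRoots (f : ℤ[X]) : Multiset (PadicAlgCl p) :=
  (f.aroots (PadicAlgCl p)).filter (fun β => ‖β‖ = 1)

/-- The set of the multiplicative orders `N(β)`, for `β` a root of `f` on the unit circle. -/
def orderSet (f : ℤ[X]) : Finset ℕ := ((unitRoots p f).map (residueOrder p)).toFinset

/-- The maximum of the `s_p(β)`, for `β` a root of `f` on the unit circle (`0` if there is none). -/
def levelBound (f : ℤ[X]) : ℕ := ((unitRoots p f).map (sInv p)).sup

/-- The roots `β` of `f` on the unit circle, with multiplicity, such that `N(β)` belongs to `S`. -/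
def unitRootsIn (f : ℤ[X]) (S : Finset ℕ) : Multiset (PadicAlgCl p) :=
  (unitRoots p f).filter (fun β => residueOrder p β ∈ S)

/-- The sum, over the roots `β` of `f` on the unit circle with `N(β) ∈ S`, of
`ord_p(β ^ (p ^ m) - τ(π(β)) ^ (p ^ m)) - m`, where `m = min(r, s_p(β))`. -/
def unitRootSum (f : ℤ[X]) (S : Finset ℕ) (r : ℕ) : ℝ :=
  ((unitRootsIn p f S).map (fun β =>
    ordP p (β ^ p ^ min r (sInv p β) -
      teichmuller p (reduction p β) ^ p ^ min r (sInv p β)) - (min r (sInv p β) : ℕ))).sum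

/-- The set of those `n ≥ 1` such that exactly those elements of `N` that lie in `S` divide `n`,
and such that `ord_p n` equals `r` if `r < R`, and is at least `R` otherwise. -/
def divClass (N : Finset ℕ) (R : ℕ) (S : Finset ℕ) (r : ℕ) : Set ℕ :=
  {n | 1 ≤ n ∧ (∀ d ∈ S, d ∣ n) ∧ (∀ d ∈ N \ S, ¬ d ∣ n) ∧
    (r < R → padicValNat p n = r) ∧ (r = R → R ≤ padicValNat p n)}

end IharaTower

end

open scoped LaurentPolynomial Polynomial

/-! The proof reduces the count of spanning trees to a product over `n`-th roots of unity and then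
reads off the absolute value of each factor.

Let `L(z)` be the Laplacian of `X` twisted by `z ^ α`, so that `det L(z) = I_α(z)`. If `M` is the
Laplacian of a graph with `m` vertices, adding `x` to every entry gives the determinant `x m² κ`, by
the matrix-tree theorem. For the layer `X_n` with `x = 1`, the characters `ψ(k)` of `ℤ/n`
diagonalize the resulting block circulant matrix: the trivial one gives `L(1)` plus the constant
`n`, the others give `L(ψ(k))`. Hence `n κ(X_n) = κ(X) ∏_{k ≠ 0} I_α(ψ(k))`
(`natCast_mul_kappa_layer`).

Now `I_α` is a power of `t` times `(t - 1)^e J`, and `∏_{k ≠ 0} (1 - ψ(k)) = n`. With `c` the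
leading coefficient of `J` and `β` running through its roots, this becomes `|n| |κ(X_n)| |J(1)| =
|κ(X)| |n|^e |c|^n ∏ |β^n - 1|` (`norm_kappa_layer`), where `|J(1)| = |Δ_1(J)|`.

A root with `|β| < 1` contributes `1` and one with `|β| > 1` contributes `|β|^n`; together with
`|c|^n` this is the `n`-th power of the Mahler measure, whence `μ_p`. A root with `|β| = 1`
contributes `1` unless `N(β) ∣ n`. In that case `τ^n = 1`, so `|β^n - 1| = |u^n - 1|` for the
principal unit `u = β/τ`. The part of `n` prime to `p` has no effect, and from the exponent `p^s`
on, every further factor `p` multiplies the distance to `1` by exactly `|p|`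
(`norm_pow_prime_pow_sub_one`, `ordP_pow_sub_one`). This gives `λ_p` and `ν_p`.

Integrality of `ν_p` is also needed for empty classes. It follows from the formula itself by
induction over the orders `N_j` (`unitRootSum_mem_range`), once `μ_p` is known to be an integer by
Gauss's lemma (`muInv_mem_range`). -/

noncomputable section

namespace SerreGraph

/-! ### Spanning trees and parent maps -/

variable {V E : Type*}

/-- A choice of an outgoing edge at every vertex other than `r`. -/
abbrev ParentMap (X : SerreGraph V E) (r : V) := ∀ v : {v : V // ¬ v = r}, {e : E // X.o e = v.1}

namespace ParentMap

variable {X : SerreGraph V E} {r : V}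

open Classical in
/-- The end of the edge chosen at `v`, and `r` at the root. -/
def next (f : X.ParentMap r) (v : V) : V := if h : v = r then r else X.t (f ⟨v, h⟩).1

/-- Every vertex is led to the root. -/
def Acyclic (f : X.ParentMap r) : Prop := ∀ v, ∃ k, f.next^[k] v = r

/-- The chosen edges and their inverses. -/
def edges (f : X.ParentMap r) : Set E := {e | ∃ v, e = (f v).1 ∨ e = X.inv (f v).1}

/-- The simple graph underlying a set of edges. -/
abbrev _root_.SerreGraph.simple (X : SerreGraph V E) (T : Set E) : SimpleGraph V :=
  SimpleGraph.fromRel (fun v w => ∃ e ∈ T, X.o e = v ∧ X.t e = w)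

lemma next_of_ne (f : X.ParentMap r) {v : V} (h : ¬ v = r) : f.next v = X.t (f ⟨v, h⟩).1 :=
  dif_neg h

@[simp] lemma next_root (f : X.ParentMap r) : f.next r = r := dif_pos rfl

open Classical in
/-- The number of steps to the root. -/
def depth {f : X.ParentMap r} (hf : f.Acyclic) (v : V) : ℕ := Nat.find (hf v)

lemma depth_next {f : X.ParentMap r} (hf : f.Acyclic) {v : V} (h : ¬ v = r) :
    depth hf (f.next v) < depth hf v := by
  classical
  have h1 := Nat.find_spec (hf v)
  have h0 : Nat.find (hf v) ≠ 0 := by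
    intro h0
    rw [h0] at h1
    exact h h1
  obtain ⟨k, hk⟩ := Nat.exists_eq_succ_of_ne_zero h0
  have : depth hf (f.next v) ≤ k := by
    refine Nat.find_min' (hf (f.next v)) ?_
    rw [hk, Function.iterate_succ_apply] at h1
    exact h1
  have h2 : depth hf v = k + 1 := hk
  omega

lemma acyclic_of_depth {f : X.ParentMap r} (d : V → ℕ) (hd : ∀ v, ¬ v = r → d (f.next v) < d v) :
    f.Acyclic := by
  intro v
  induction hn : d v using Nat.strong_induction_on generalizing v with
  | _ n ih =>
    by_cases h : v = r
    · exact ⟨0, h⟩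
    · obtain ⟨k, hk⟩ := ih _ (hn ▸ hd v h) (f.next v) rfl
      exact ⟨k + 1, hk⟩

lemma next_ne_self {f : X.ParentMap r} (hf : f.Acyclic) {v : V} (h : ¬ v = r) : f.next v ≠ v :=
  fun h1 => (depth_next hf h).ne (congrArg _ h1)

/-- Depth drops at each step away from the root, so there are no 2-cycles: no edge is chosen from
both of its ends. This gives the absence of multiple edges and the injectivity of `edges`. -/
lemma next_next_ne_self {f : X.ParentMap r} (hf : f.Acyclic) {v : V} (h : ¬ v = r) :
    f.next (f.next v) ≠ v := by
  intro h1
  have h2 := depth_next hf h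
  by_cases h3 : f.next v = r
  · rw [h3, next_root] at h1
    exact h h1.symm
  · have h4 := depth_next hf h3
    rw [h1] at h4
    omega

lemma mem_edges (f : X.ParentMap r) (v) : (f v).1 ∈ f.edges := ⟨v, Or.inl rfl⟩

lemma inv_mem_edges (f : X.ParentMap r) {e : E} (he : e ∈ f.edges) : X.inv e ∈ f.edges := by
  obtain ⟨v, rfl | rfl⟩ := he
  · exact ⟨v, Or.inr rfl⟩
  · exact ⟨v, Or.inl (X.inv_inv _)⟩

lemma adj_next {f : X.ParentMap r} (hf : f.Acyclic) {T : Set E} (hT : f.edges ⊆ T) {v : V}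
    (h : ¬ v = r) : (X.simple T).Adj v (f.next v) := by
  rw [SimpleGraph.fromRel_adj]
  refine ⟨(next_ne_self hf h).symm, Or.inl ⟨(f ⟨v, h⟩).1, hT (f.mem_edges _), (f ⟨v, h⟩).2, ?_⟩⟩
  rw [next_of_ne f h]

lemma connected_simple {f : X.ParentMap r} (hf : f.Acyclic) : (X.simple f.edges).Connected := by
  have key : ∀ v, (X.simple f.edges).Reachable v r := by
    intro v
    induction hn : depth hf v using Nat.strong_induction_on generalizing v with
    | _ n ih =>
      by_cases h : v = r
      · rw [h]
      · exact (adj_next hf subset_rfl h).reachable.trans (ih _ (hn ▸ depth_next hf h) _ rfl)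
  have : Nonempty V := ⟨r⟩
  exact ⟨fun v w => (key v).trans (key w).symm⟩

/-- Each non-root vertex accounts for at most one edge; this is the upper bound on the edge count
that turns connectedness into being a tree. -/
lemma edgeSet_simple_subset (f : X.ParentMap r) :
    (X.simple f.edges).edgeSet ⊆ Set.range (fun v : {v : V // ¬ v = r} => s(v.1, f.next v.1)) := by
  have key : ∀ v w, (∃ e ∈ f.edges, X.o e = v ∧ X.t e = w) →
      s(v, w) ∈ Set.range (fun v : {v : V // ¬ v = r} => s(v.1, f.next v.1)) := by
    rintro v w ⟨e, ⟨u, rfl | rfl⟩, rfl, rfl⟩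
    · exact ⟨u, by simp only [next_of_ne f u.2, (f u).2]⟩
    · exact ⟨u, by simp only [next_of_ne f u.2, X.o_inv, X.t_inv, (f u).2]; exact Sym2.eq_swap⟩
  intro e
  induction e using Sym2.ind with
  | _ v w =>
    rw [SimpleGraph.mem_edgeSet, SimpleGraph.fromRel_adj]
    rintro ⟨-, h | h⟩
    · exact key _ _ h
    · rw [Sym2.eq_swap]; exact key _ _ h

lemma isTree_simple [Finite V] {f : X.ParentMap r} (hf : f.Acyclic) :
    (X.simple f.edges).IsTree := by
  rw [SimpleGraph.isTree_iff_connected_and_card]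
  refine ⟨connected_simple hf, le_antisymm ?_ (connected_simple hf).card_vert_le_card_edgeSet_add_one⟩
  have h1 : Nat.card (X.simple f.edges).edgeSet ≤ Nat.card {v : V // ¬ v = r} := by
    refine (Nat.card_mono (Set.toFinite _) f.edgeSet_simple_subset).trans ?_
    exact Finite.card_range_le _
  have h2 : Nat.card {v : V // ¬ v = r} + 1 = Nat.card V := by
    classical
    have := Fintype.ofFinite V
    rw [Nat.card_eq_fintype_card, Nat.card_eq_fintype_card, Fintype.card_subtype_compl]
    simp only [Fintype.card_subtype_eq]
    have : 0 < Fintype.card V := Fintype.card_pos_iff.2 ⟨r⟩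
    omega
  omega

lemma isSpanningTree [Finite V] {f : X.ParentMap r} (hf : f.Acyclic) :
    X.IsSpanningTree f.edges where
  inv_mem _ he := f.inv_mem_edges he
  no_loop := by
    have key : ∀ v, X.o (f v).1 ≠ X.t (f v).1 := fun v h =>
      next_ne_self hf v.2 (by rw [next_of_ne f v.2, ← h, (f v).2])
    rintro e ⟨v, rfl | rfl⟩
    · exact key v
    · rw [X.o_inv, X.t_inv]; exact (key v).symm
  no_multiple := by
    have key1 : ∀ v w, X.o (f v).1 = X.o (f w).1 → (f v).1 = (f w).1 := by
      intro v w h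
      rw [(f v).2, (f w).2] at h
      obtain rfl := Subtype.ext h
      rfl
    have key2 : ∀ v w, X.o (f v).1 = X.t (f w).1 → X.t (f v).1 = X.o (f w).1 → False := by
      intro v w h1 h2
      rw [(f v).2, ← next_of_ne f w.2] at h1
      rw [(f w).2, ← next_of_ne f v.2] at h2
      exact next_next_ne_self hf v.2 (by rw [h2, ← h1])
    rintro e ⟨v, rfl | rfl⟩ e' ⟨w, rfl | rfl⟩ ho ht
    · exact key1 v w ho
    · rw [X.o_inv] at ho
      rw [X.t_inv] at ht
      exact (key2 v w ho ht).elim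
    · rw [X.o_inv] at ho
      rw [X.t_inv] at ht
      exact (key2 w v ho.symm ht.symm).elim
    · rw [X.t_inv, X.t_inv] at ht
      rw [key1 v w ht]
  isTree := isTree_simple hf

/-- A disagreement propagates toward the root. If `f v ≠ g v`, the edge `f v` can only occur in
`g.edges` as the inverse of the edge `g` chooses at `w = f.next v`; and `f w = g w` would lead `f`
back to `v`. Since depth decreases along the way, this cannot go on. -/
lemma edges_injective {f g : X.ParentMap r} (hf : f.Acyclic) (h : f.edges = g.edges) : f = g := by
  by_contra hfg
  obtain ⟨v₀, hv₀⟩ := Function.ne_iff.1 hfg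
  have step : ∀ v, f v ≠ g v → ∃ w, w.1 = f.next v.1 ∧ f w ≠ g w := by
    intro v hv
    obtain ⟨w, hw | hw⟩ : (f v).1 ∈ g.edges := h ▸ f.mem_edges v
    · have : v = w := Subtype.ext (by rw [← (f v).2, hw, (g w).2])
      subst this
      exact (hv (Subtype.ext hw)).elim
    · have hvw : w.1 = f.next v.1 := by
        rw [next_of_ne f v.2, ← (g w).2]
        exact (X.t_inv _).symm.trans (congrArg X.t hw.symm)
      refine ⟨w, hvw, fun hh => next_next_ne_self hf v.2 ?_⟩
      rw [← hvw, next_of_ne f w.2]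
      change X.t (f w).1 = v.1
      rw [hh, ← (f v).2, hw, X.o_inv]
  have key : ∀ n (v : {v : V // ¬ v = r}), depth hf v.1 = n → f v = g v := by
    intro n
    induction n using Nat.strong_induction_on with
    | _ n ih =>
      intro v hn
      by_contra hv
      obtain ⟨w, hw, hw'⟩ := step v hv
      exact hw' (ih _ (hn ▸ hw ▸ depth_next hf v.2) w rfl)
  exact hv₀ (key _ v₀ rfl)

/-- Choose at each vertex the first edge of a shortest path to `r`; the distance to `r` then serves
as the depth. -/
lemma exists_acyclic {T : Set E} (hinv : ∀ e ∈ T, X.inv e ∈ T) (h : (X.simple T).Connected)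
    (r : V) : ∃ f : X.ParentMap r, f.Acyclic ∧ f.edges ⊆ T := by
  have key : ∀ v : {v : V // ¬ v = r}, ∃ e : {e : E // X.o e = v.1}, e.1 ∈ T ∧
      (X.simple T).dist (X.t e.1) r < (X.simple T).dist v.1 r := by
    intro v
    obtain ⟨v, hv⟩ := v
    obtain ⟨q, hq⟩ := h.exists_walk_length_eq_dist v r
    cases q with
    | nil => exact (hv rfl).elim
    | @cons _ w _ hadj q =>
      have hw : (X.simple T).dist w r < (X.simple T).dist v r := by
        rw [← hq, SimpleGraph.Walk.length_cons]
        exact Nat.lt_succ_of_le (SimpleGraph.dist_le q)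
      rw [SimpleGraph.fromRel_adj] at hadj
      obtain ⟨-, ⟨e, he, h1, h2⟩ | ⟨e, he, h1, h2⟩⟩ := hadj
      · exact ⟨⟨e, h1⟩, he, by simpa only [h2] using hw⟩
      · exact ⟨⟨X.inv e, by rw [X.o_inv, h2]⟩, hinv e he, by simpa only [X.t_inv, h1] using hw⟩
  choose f hf1 hf2 using key
  refine ⟨f, acyclic_of_depth (fun v => (X.simple T).dist v r) ?_, ?_⟩
  · intro v hv
    rw [next_of_ne f hv]
    exact hf2 ⟨v, hv⟩
  · rintro e ⟨v, rfl | rfl⟩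
    · exact hf1 v
    · exact hinv _ (hf1 v)

/-- Both underlying simple graphs are trees on `V`, so they have equally many edges and coincide.
Absence of loops and multiple edges in `T` lifts this to the directed edges. -/
lemma edges_eq_of_subset [Finite V] {f : X.ParentMap r} (hf : f.Acyclic) {T : Set E}
    (hT : X.IsSpanningTree T) (hfT : f.edges ⊆ T) : f.edges = T := by
  have hle : X.simple f.edges ≤ X.simple T := by
    intro v w
    simp only [SimpleGraph.fromRel_adj]
    rintro ⟨h0, ⟨e, he, h⟩ | ⟨e, he, h⟩⟩
    · exact ⟨h0, Or.inl ⟨e, hfT he, h⟩⟩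
    · exact ⟨h0, Or.inr ⟨e, hfT he, h⟩⟩
  have heq : (X.simple f.edges).edgeSet = (X.simple T).edgeSet := by
    refine Set.eq_of_subset_of_ncard_le (SimpleGraph.edgeSet_mono hle) ?_ (Set.toFinite _)
    have h1 := (SimpleGraph.isTree_iff_connected_and_card.1 (isTree_simple hf)).2
    have h2 := (SimpleGraph.isTree_iff_connected_and_card.1 hT.isTree).2
    rw [← Nat.card_coe_set_eq, ← Nat.card_coe_set_eq]
    change Nat.card (X.simple T).edgeSet + 1 = _ at h2
    omega
  refine hfT.antisymm fun e he => ?_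
  have hadj : (X.simple f.edges).Adj (X.o e) (X.t e) := by
    rw [← SimpleGraph.mem_edgeSet, heq, SimpleGraph.mem_edgeSet, SimpleGraph.fromRel_adj]
    exact ⟨hT.no_loop e he, Or.inl ⟨e, he, rfl, rfl⟩⟩
  rw [SimpleGraph.fromRel_adj] at hadj
  obtain ⟨-, ⟨e', he', h1, h2⟩ | ⟨e', he', h1, h2⟩⟩ := hadj
  · rwa [← hT.no_multiple e' (hfT he') e he h1 h2]
  · rw [← hT.no_multiple (X.inv e') (hT.inv_mem _ (hfT he')) e he (by rw [X.o_inv, h2])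
      (by rw [X.t_inv, h1])]
    exact f.inv_mem_edges he'

end ParentMap

open ParentMap

/-- Spanning trees correspond to acyclic parent maps. -/
lemma kappa_eq_card_acyclic [Finite V] (X : SerreGraph V E) (r : V) :
    X.kappa = Nat.card {f : X.ParentMap r // f.Acyclic} := by
  symm
  refine Nat.card_eq_of_bijective
    (fun f : {f : X.ParentMap r // f.Acyclic} => (⟨f.1.edges, isSpanningTree f.2⟩ :
      {T : Set E // X.IsSpanningTree T})) ⟨?_, ?_⟩
  · intro f g h
    exact Subtype.ext (edges_injective f.2 (congrArg Subtype.val h))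
  · rintro ⟨T, hT⟩
    obtain ⟨f, hf, hfT⟩ := exists_acyclic hT.inv_mem hT.isTree.connected r
    exact ⟨⟨f, hf⟩, Subtype.ext (edges_eq_of_subset hf hT hfT)⟩

lemma kappa_ne_zero [Finite V] [Finite E] [Nonempty V] (X : SerreGraph V E) (hX : X.Connected) :
    X.kappa ≠ 0 := by
  classical
  obtain ⟨r⟩ := ‹Nonempty V›
  have hc : (X.simple Set.univ).Connected := by
    have : Nonempty V := ⟨r⟩
    refine ⟨fun v w => ?_⟩
    induction hX v w with
    | refl => exact SimpleGraph.Reachable.refl _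
    | @tail b c _ h ih =>
      obtain ⟨e, rfl, rfl⟩ := h
      by_cases h : X.o e = X.t e
      · rwa [← h]
      · refine ih.trans (SimpleGraph.Adj.reachable ?_)
        rw [SimpleGraph.fromRel_adj]
        exact ⟨h, Or.inl ⟨e, trivial, rfl, rfl⟩⟩
  obtain ⟨f, hf, -⟩ := exists_acyclic (X := X) (fun _ _ => Set.mem_univ _) hc r
  rw [X.kappa_eq_card_acyclic r]
  have : Nonempty {f : X.ParentMap r // f.Acyclic} := ⟨⟨f, hf⟩⟩
  exact Nat.card_pos.ne'

/-! ### The matrix-tree theorem -/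

variable [Fintype V] [DecidableEq V]

/-- The Laplacian: the valency matrix minus the adjacency matrix. -/
def lap [Fintype E] (X : SerreGraph V E) (R : Type*) [CommRing R] : Matrix V V R :=
  Matrix.of fun v w => ∑ e : {e : E // X.o e = v},
    ((if v = w then 1 else 0) - (if X.t e.1 = w then 1 else 0))

variable {X : SerreGraph V E} {r : V} {R : Type*} [CommRing R]

/-- The matrix of a parent map on the vertices other than the root. -/
def ParentMap.mat (f : X.ParentMap r) (R : Type*) [CommRing R] :
    Matrix {v : V // ¬ v = r} {v : V // ¬ v = r} R :=
  fun v w => (if v.1 = w.1 then 1 else 0) - (if X.t (f v).1 = w.1 then 1 else 0)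

/-- Sorted by depth, the matrix is block triangular with identity blocks on the diagonal, as an edge
always leads to smaller depth. -/
lemma ParentMap.det_mat_of_acyclic {f : X.ParentMap r} (hf : f.Acyclic) : (f.mat R).det = 1 := by
  have hb : (f.mat R).BlockTriangular (fun v => OrderDual.toDual (depth hf v.1)) := by
    intro v w h
    have h : depth hf v.1 < depth hf w.1 := h
    have h1 : v.1 ≠ w.1 := fun h1 => by rw [h1] at h; exact lt_irrefl _ h
    have h2 : X.t (f v).1 ≠ w.1 := fun h2 => by
      have := depth_next hf v.2
      rw [next_of_ne f v.2] at this
      rw [← h2] at h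
      exact lt_asymm h this
    simp [ParentMap.mat, h1, h2]
  rw [hb.det]
  refine Finset.prod_eq_one fun d _ => ?_
  suffices h : (f.mat R).toSquareBlock (fun v => OrderDual.toDual (depth hf v.1)) d = 1 by
    rw [h, Matrix.det_one]
  ext ⟨v, hv⟩ ⟨w, hw⟩
  have h2 : X.t (f v).1 ≠ w.1 := fun h2 => by
    have h3 := depth_next hf v.2
    rw [next_of_ne f v.2, Subtype.coe_eta, h2] at h3
    have h4 : depth hf v.1 = depth hf w.1 := OrderDual.toDual_inj.1 (hv.trans hw.symm)
    omega
  simp [Matrix.toSquareBlock, Matrix.toSquareBlockProp, ParentMap.mat, h2, Matrix.one_apply,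
    Subtype.ext_iff]

/-- The indicator function of the vertices that never reach the root is a nonzero kernel vector: a
vertex reaches the root if and only if its successor does. -/
lemma ParentMap.det_mat_of_not_acyclic [IsDomain R] {f : X.ParentMap r} (hf : ¬ f.Acyclic) :
    (f.mat R).det = 0 := by
  classical
  rw [← Matrix.exists_mulVec_eq_zero_iff]
  refine ⟨fun v => if ∃ k, f.next^[k] v.1 = r then 0 else 1, ?_, ?_⟩
  · rw [Acyclic, not_forall] at hf
    obtain ⟨v, hv⟩ := hf
    have hvr : ¬ v = r := fun h => hv ⟨0, h⟩
    intro h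
    have := congrFun h ⟨v, hvr⟩
    simp [hv] at this
  · ext v
    have hiff : (∃ k, f.next^[k] v.1 = r) ↔ ∃ k, f.next^[k] (X.t (f v).1) = r := by
      have hn : f.next v.1 = X.t (f v).1 := next_of_ne f v.2
      constructor
      · rintro ⟨k, hk⟩
        refine ⟨k, ?_⟩
        rw [← hn, ← Function.iterate_succ_apply, Function.iterate_succ_apply', hk, next_root]
      · rintro ⟨k, hk⟩
        refine ⟨k + 1, ?_⟩
        rw [Function.iterate_succ_apply, hn, hk]
    simp only [Matrix.mulVec, dotProduct, ParentMap.mat, sub_mul, Finset.sum_sub_distrib,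
      Pi.zero_apply, ite_mul, one_mul, zero_mul]
    have h1 : ∀ u : V, (∑ x : {v : V // ¬ v = r}, if u = x.1 then
        (if ∃ k, f.next^[k] x.1 = r then (0 : R) else 1) else 0) =
        if ∃ k, f.next^[k] u = r then 0 else 1 := by
      intro u
      by_cases hu : u = r
      · subst hu
        rw [if_pos ⟨0, rfl⟩]
        exact Finset.sum_eq_zero fun x _ => if_neg fun h => x.2 h.symm
      · rw [Finset.sum_eq_single ⟨u, hu⟩]
        · simp
        · intro b _ hb
          exact if_neg fun h => hb (Subtype.ext h.symm)
        · simp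
    rw [h1, h1, sub_eq_zero]
    simp only [hiff]

/-- The matrix-tree theorem. -/
theorem det_reduced_lap [Fintype E] [IsDomain R] (X : SerreGraph V E) (r : V) :
    ((X.lap R).toSquareBlockProp fun v => ¬ v = r).det = X.kappa := by
  classical
  have h : (X.lap R).toSquareBlockProp (fun v => ¬ v = r) =
      fun v : {v : V // ¬ v = r} => ∑ e : {e : E // X.o e = v.1}, (fun w : {v : V // ¬ v = r} =>
        ((if v.1 = w.1 then (1 : R) else 0) - (if X.t e.1 = w.1 then 1 else 0))) := by
    ext v w
    simp [Matrix.toSquareBlockProp, lap]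
  rw [h]
  -- Row `v` is a sum over the edges leaving `v`, so multilinearity expands the determinant into a
  -- sum over parent maps, of which exactly the acyclic ones contribute `1`.
  have h2 := (Matrix.detRowAlternating (n := {v : V // ¬ v = r}) (R := R)).toMultilinearMap.map_sum
    (g := fun (v : {v : V // ¬ v = r}) (e : {e : E // X.o e = v.1}) (w : {v : V // ¬ v = r}) =>
        ((if v.1 = w.1 then (1 : R) else 0) - (if X.t e.1 = w.1 then 1 else 0)))
  refine h2.trans ?_
  have h3 : ∀ f : X.ParentMap r, (f.mat R).det = if f.Acyclic then 1 else 0 := by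
    intro f
    split_ifs with hf
    · exact f.det_mat_of_acyclic hf
    · exact f.det_mat_of_not_acyclic hf
  refine (Finset.sum_congr rfl fun f _ => h3 f).trans ?_
  rw [Finset.sum_boole, X.kappa_eq_card_acyclic r, Nat.card_eq_fintype_card, Fintype.card_subtype]

end SerreGraph

/-! ### Determinants -/

namespace Matrix

variable {V K : Type*} [Fintype V] [DecidableEq V] [Field K]

/-- The determinant of a matrix with vanishing row and column sums, after adding a constant to all
the entries. -/
lemma det_add_const_of_sum_eq_zero [CharZero K] (M : Matrix V V K) (hrow : ∀ v, ∑ w, M v w = 0)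
    (hcol : ∀ w, ∑ v, M v w = 0) (r : V) (x : K) :
    (M + of fun _ _ => x).det =
      x * (Fintype.card V : K) ^ 2 * (M.toSquareBlockProp fun v => ¬ v = r).det := by
  have hm : (Fintype.card V : K) ≠ 0 := Nat.cast_ne_zero.2 (Fintype.card_pos_iff.2 ⟨r⟩).ne'
  set m : K := (Fintype.card V : K)
  -- Adding all rows to row `r` makes that row constant `m x`; multiples `m⁻¹` of it then clear `x`
  -- from the other rows. Adding all columns to column `r` leaves `m (m x)` in row `r` and zeros
  -- elsewhere in that column.
  have h1 : (M + of fun _ _ => x).det = (updateRow (M + of fun _ _ => x) r fun _ => m * x).det := by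
    have := det_updateRow_sum (M + of fun _ _ => x) r (fun _ => 1)
    rw [one_smul] at this
    rw [← this]
    congr 2
    ext w
    simp only [one_smul]
    refine (Finset.sum_apply w Finset.univ _).trans ?_
    simp [Finset.sum_add_distrib, hcol, m]
  have h2 : (updateRow (M + of fun _ _ => x) r fun _ => m * x).det =
      (updateRow M r fun _ => m * x).det := by
    refine det_eq_of_forall_row_eq_smul_add_const (fun i => if i = r then 0 else m⁻¹) r
      (if_pos rfl) fun i j => ?_
    by_cases h : i = r
    · subst h; simp
    · simp [h, hm]
  have h3 : (updateRow M r fun _ => m * x).det =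
      (updateCol (updateRow M r fun _ => m * x) r fun v => if v = r then m * (m * x) else 0).det := by
    have := det_updateCol_sum (updateRow M r fun _ => m * x) r (fun _ => 1)
    rw [one_smul] at this
    rw [← this]
    congr 2
    ext v
    by_cases h : v = r
    · subst h; simp [m]
    · simp [h, hrow]
  rw [h1, h2, h3, twoBlockTriangular_det _ (fun v => v = r)]
  · have h5 : (toSquareBlockProp (updateCol (updateRow M r fun _ => m * x) r
        fun v => if v = r then m * (m * x) else 0) fun v => ¬ v = r) =
        M.toSquareBlockProp fun v => ¬ v = r := by
      ext ⟨v, hv⟩ ⟨w, hw⟩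
      simp [toSquareBlockProp, updateCol_ne hw, updateRow_ne hv]
    refine (congrArg₂ (· * ·) (x' := m * (m * x)) ?_ (congrArg det h5)).trans (by ring)
    have h6 : ((default : {v // v = r}) : V) = r := (default : {v // v = r}).2
    refine (@det_unique K _ {v // v = r} _ _ (Subtype.fintype _) _).trans ?_
    simp [toSquareBlockProp, h6]
  · intro i hi j hj
    subst hj
    simp [hi]

/-- The determinant of a block circulant matrix. -/
lemma det_block_circulant {n : ℕ} [NeZero n] (hn : (n : K) ≠ 0) {ψ : AddChar (ZMod n) K}
    (hψ : ψ.IsPrimitive) (g : V → V → ZMod n → K) :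
    (of fun x y : V × ZMod n => g x.1 y.1 (y.2 - x.2)).det =
      ∏ k : ZMod n, (of fun v w => ∑ c, g v w c * ψ (c * k)).det := by
  -- The Fourier matrix in the `ZMod n` coordinate; orthogonality of characters makes `Φ'` its
  -- inverse up to the factor `n`. Conjugation by it makes the circulant block diagonal.
  set Φ : Matrix (V × ZMod n) (V × ZMod n) K :=
    of fun x y => if x.1 = y.1 then ψ (x.2 * y.2) else 0 with hΦ
  set Φ' : Matrix (V × ZMod n) (V × ZMod n) K :=
    of fun x y => if x.1 = y.1 then ψ (-(x.2 * y.2)) else 0 with hΦ'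
  have h1 : Φ * Φ' = (n : K) • (1 : Matrix (V × ZMod n) (V × ZMod n) K) := by
    ext ⟨v, a⟩ ⟨w, b⟩
    simp only [mul_apply, hΦ, hΦ', of_apply, Fintype.sum_prod_type, smul_apply, one_apply,
      Prod.mk.injEq, smul_eq_mul]
    rw [Finset.sum_eq_single v]
    · by_cases h : v = w
      · subst h
        simp only [if_true, true_and]
        have : ∀ x : ZMod n, ψ (a * x) * ψ (-(x * b)) = ψ (x * (a - b)) := by
          intro x
          rw [← AddChar.map_add_eq_mul]
          congr 1
          ring
        simp only [this]
        rw [AddChar.sum_mulShift _ hψ]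
        simp [sub_eq_zero, ZMod.card]
      · simp [h]
    · intro u _ hu
      simp [Ne.symm hu]
    · simp
  have hdet : Φ.det ≠ 0 := by
    intro h0
    have := congrArg det h1
    rw [det_mul, h0, zero_mul, det_smul, det_one, mul_one] at this
    exact pow_ne_zero _ hn this.symm
  have h2 : (of fun x y : V × ZMod n => g x.1 y.1 (y.2 - x.2)) * Φ =
      Φ * blockDiagonal fun k => of fun v w => ∑ c, g v w c * ψ (c * k) := by
    ext ⟨v, a⟩ ⟨w, k⟩
    simp only [mul_apply, hΦ, of_apply, Fintype.sum_prod_type, blockDiagonal_apply]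
    rw [Finset.sum_eq_single w, Finset.sum_eq_single v]
    · simp only [if_true, mul_ite, mul_zero, Finset.sum_ite_eq', Finset.mem_univ]
      rw [Finset.mul_sum]
      refine Fintype.sum_equiv (Equiv.subRight a) _ _ fun b => ?_
      simp only [Equiv.subRight_apply]
      rw [mul_left_comm, ← AddChar.map_add_eq_mul]
      congr 2
      ring
    · intro u _ hu
      simp [Ne.symm hu]
    · simp
    · intro u _ hu
      simp [hu]
    · simp
  have h3 := congrArg det h2
  rw [det_mul, det_mul, det_blockDiagonal, mul_comm] at h3
  exact mul_left_cancel₀ hdet h3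

end Matrix

namespace SerreGraph

/-! ### The number of spanning trees of the layers -/

variable {V E : Type*} [DecidableEq V] [Fintype E] {K : Type*} [Field K]

lemma sum_subtype_eq_sum_ite {ι M : Type*} [Fintype ι] [AddCommMonoid M] (q : ι → Prop)
    [DecidablePred q] (f : ι → M) : ∑ i : {i // q i}, f i.1 = ∑ i, if q i then f i else 0 := by
  rw [← Finset.sum_filter]
  exact (Finset.sum_subtype _ (by simp) f).symm

lemma lap_apply (X : SerreGraph V E) (R : Type*) [CommRing R] (v w : V) : X.lap R v w =
    ∑ e, if X.o e = v then ((if v = w then 1 else 0) - (if X.t e = w then 1 else 0)) else 0 :=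
  sum_subtype_eq_sum_ite (fun e => X.o e = v)
    (fun e => ((if v = w then (1 : R) else 0) - (if X.t e = w then 1 else 0)))

lemma sum_lap_row [Fintype V] (X : SerreGraph V E) (R : Type*) [CommRing R] (v : V) :
    ∑ w, X.lap R v w = 0 := by
  simp only [lap, Matrix.of_apply]
  rw [Finset.sum_comm]
  simp

lemma sum_lap_col [Fintype V] (X : SerreGraph V E) (R : Type*) [CommRing R] (w : V) :
    ∑ v, X.lap R v w = 0 := by
  simp only [lap_apply]
  rw [Finset.sum_comm]
  simp only [Finset.sum_ite_eq, Finset.mem_univ, if_true, Finset.sum_sub_distrib, sub_eq_zero]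
  refine Fintype.sum_equiv ⟨X.inv, X.inv, X.inv_inv, X.inv_inv⟩ _ _ fun e => ?_
  simp [X.t_inv]

/-- The Laplacian twisted by the voltage assignment at `z`. -/
def lapAt (X : SerreGraph V E) (α : X.Voltage ℤ) (z : K) : Matrix V V K :=
  Matrix.of fun v w =>
    ∑ e, if X.o e = v then ((if v = w then 1 else 0) - (if X.t e = w then z ^ α.val e else 0)) else 0

lemma lapAt_one (X : SerreGraph V E) (α : X.Voltage ℤ) : X.lapAt α (1 : K) = X.lap K := by
  ext v w
  simp [lapAt, lap_apply]

variable [Fintype V]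

lemma det_lap_add_const [CharZero K] [Nonempty V] (X : SerreGraph V E) (x : K) :
    (X.lap K + Matrix.of fun _ _ => x).det = x * (Fintype.card V : K) ^ 2 * X.kappa := by
  obtain ⟨r⟩ := ‹Nonempty V›
  rw [Matrix.det_add_const_of_sum_eq_zero _ (X.sum_lap_row K) (X.sum_lap_col K) r,
    X.det_reduced_lap r]

lemma eval_iharaPoly (X : SerreGraph V E) (α : X.Voltage ℤ) (z : Kˣ) :
    LaurentPolynomial.eval₂ (Int.castRingHom K) z (X.iharaPoly α) = (X.lapAt α (z : K)).det := by
  rw [iharaPoly, RingHom.map_det]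
  congr 1
  ext v w
  simp only [RingHom.mapMatrix_apply, Matrix.map_apply, Matrix.sub_apply, Matrix.diagonal_apply,
    Matrix.of_apply, map_sub, map_sum, LaurentPolynomial.eval₂_T, lapAt, Units.val_zpow_eq_zpow_val]
  rw [← Finset.sum_filter, Finset.sum_sub_distrib]
  congr 1
  · split_ifs <;> simp
  · rw [← Finset.sum_filter, Finset.filter_filter]

/-- The Laplacian of the layer alone is singular. The all-ones matrix repairs this and is seen by
the trivial character only, where it becomes the constant `n`; the nontrivial blocks remain the
twisted Laplacians. -/
lemma det_lap_layer_add_one {n : ℕ} [NeZero n] [CharZero K] {ψ : AddChar (ZMod n) K}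
    (hψ : ψ.IsPrimitive) (X : SerreGraph V E) (α : X.Voltage ℤ) :
    ((X.layer α n).lap K + Matrix.of fun _ _ => (1 : K)).det =
      (X.lap K + Matrix.of fun _ _ => (n : K)).det *
        ∏ k ∈ Finset.univ.erase (0 : ZMod n), (X.lapAt α (ψ k)).det := by
  have hn : (n : K) ≠ 0 := Nat.cast_ne_zero.2 (NeZero.ne n)
  set g : V → V → ZMod n → K := fun v w c =>
    (∑ e, if X.o e = v then ((if v = w ∧ c = 0 then 1 else 0) -
      (if X.t e = w ∧ c = (α.val e : ZMod n) then 1 else 0)) else 0) + 1 with hg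
  have h1 : (X.layer α n).lap K + Matrix.of (fun _ _ => (1 : K)) =
      Matrix.of fun x y : V × ZMod n => g x.1 y.1 (y.2 - x.2) := by
    ext ⟨v, a⟩ ⟨w, b⟩
    simp only [Matrix.add_apply, Matrix.of_apply, lap_apply, hg, layer, derived, Voltage.map,
      Fintype.sum_prod_type, Prod.mk.injEq, ite_and]
    congr 1
    refine Finset.sum_congr rfl fun e _ => ?_
    by_cases h : X.o e = v
    · simp only [if_pos h]
      rw [Finset.sum_ite_eq' Finset.univ a, if_pos (Finset.mem_univ a)]
      simp only [Int.coe_castAddHom, sub_eq_iff_eq_add', @eq_comm _ a b,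
        @eq_comm _ _ b, add_zero]
    · simp [h]
  have h2 : ∀ k, (Matrix.of fun v w => ∑ c, g v w c * ψ (c * k)) =
      X.lapAt α (ψ k) + Matrix.of fun _ _ => if k = 0 then (n : K) else 0 := by
    intro k
    ext v w
    simp only [Matrix.add_apply, Matrix.of_apply, hg, add_mul, one_mul, Finset.sum_add_distrib,
      AddChar.sum_mulShift k hψ, ZMod.card, lapAt, Nat.cast_ite, Nat.cast_zero]
    congr 1
    simp only [Finset.sum_mul]
    rw [Finset.sum_comm]
    refine Finset.sum_congr rfl fun e _ => ?_
    by_cases h : X.o e = v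
    · simp only [if_pos h, sub_mul, Finset.sum_sub_distrib, ite_and, ite_mul, one_mul, zero_mul]
      congr 1
      · split_ifs <;> simp
      · by_cases h' : X.t e = w
        · simp only [if_pos h']
          rw [Finset.sum_ite_eq' Finset.univ (α.val e : ZMod n), if_pos (Finset.mem_univ _),
            ← zsmul_eq_mul, AddChar.map_zsmul_eq_zpow]
        · simp [h']
    · simp [h]
  rw [h1, Matrix.det_block_circulant hn hψ, ← Finset.mul_prod_erase _ _ (Finset.mem_univ 0), h2,
    AddChar.map_zero_eq_one, lapAt_one]
  simp only [if_true]
  congr 1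
  refine Finset.prod_congr rfl fun k hk => ?_
  rw [h2, if_neg (Finset.ne_of_mem_erase hk)]
  congr 1
  ext
  simp

/-- The number of spanning trees of the `n`-th layer. -/
theorem natCast_mul_kappa_layer {n : ℕ} [NeZero n] [CharZero K] [Nonempty V]
    {ψ : AddChar (ZMod n) K} (hψ : ψ.IsPrimitive) (X : SerreGraph V E) (α : X.Voltage ℤ) :
    (n : K) * (X.layer α n).kappa =
      X.kappa * ∏ k ∈ Finset.univ.erase (0 : ZMod n), (X.lapAt α (ψ k)).det := by
  have hn : (n : K) ≠ 0 := Nat.cast_ne_zero.2 (NeZero.ne n)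
  have hm : (Fintype.card V : K) ≠ 0 := Nat.cast_ne_zero.2 Fintype.card_pos.ne'
  have h := X.det_lap_layer_add_one hψ α
  rw [det_lap_add_const, det_lap_add_const, Fintype.card_prod, ZMod.card] at h
  push_cast at h
  refine mul_left_cancel₀ (mul_ne_zero hn (pow_ne_zero 2 hm)) ?_
  linear_combination h

end SerreGraph

namespace IharaTower

/-! ### The polynomials attached to a Laurent polynomial -/

-- The shift moves the lowest exponent to `0`, so truncating to nonnegative exponents loses nothing.
open Polynomial in
lemma toLaurent_clearedPoly (F : ℤ[T;T⁻¹]) :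
    toLaurent (clearedPoly F) = LaurentPolynomial.T (-ordZero F) * F := by
  set G : ℤ[T;T⁻¹] := LaurentPolynomial.T (-ordZero F) * F with hG
  have hcoeff : ∀ n, G.coeff n = F.coeff (n + ordZero F) := by
    intro n
    have h := AddMonoidAlgebra.coeff_single_mul_add F (1 : ℤ) (-ordZero F) (n + ordZero F)
    rw [one_mul, neg_add_cancel_comm_assoc] at h
    exact h
  have hsupp : (G.coeff.support : Set ℤ) ⊆ Set.range ((↑) : ℕ → ℤ) := by
    intro n hn
    rw [Finset.mem_coe, Finsupp.mem_support_iff, hcoeff, ← Finsupp.mem_support_iff] at hn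
    obtain ⟨a, ha⟩ := Finset.min_of_mem hn
    have h1 : ordZero F = a := by rw [ordZero, ha]; rfl
    have h2 : a ≤ n + ordZero F := Finset.min_le_of_eq hn ha
    exact ⟨n.toNat, Int.toNat_of_nonneg (by omega)⟩
  apply LaurentPolynomial.ext
  intro n
  rw [LaurentPolynomial.coeff_toLaurent]
  exact DFunLike.congr_fun
    (Finsupp.mapDomain_comapDomain ((↑) : ℕ → ℤ) Nat.cast_injective G.coeff hsupp) n

variable {K : Type*} [Field K]

lemma eval_clearedPoly (F : ℤ[T;T⁻¹]) (z : Kˣ) :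
    (clearedPoly F).eval₂ (Int.castRingHom K) z =
      (z : K) ^ (-ordZero F) * LaurentPolynomial.eval₂ (Int.castRingHom K) z F := by
  rw [← LaurentPolynomial.eval₂_toLaurent, toLaurent_clearedPoly, map_mul,
    LaurentPolynomial.eval₂_T, Units.val_zpow_eq_zpow_val]

lemma clearedPoly_ne_zero {F : ℤ[T;T⁻¹]} (hF : F ≠ 0) : clearedPoly F ≠ 0 := by
  intro h
  have h1 := toLaurent_clearedPoly F
  rw [h, map_zero] at h1
  apply hF
  have h2 : F = LaurentPolynomial.T (ordZero F) * (LaurentPolynomial.T (-ordZero F) * F) := by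
    rw [← mul_assoc, ← LaurentPolynomial.T_add]
    simp
  rw [h2, ← h1, mul_zero]

lemma pow_mul_jPoly (F : ℤ[T;T⁻¹]) :
    (Polynomial.X - Polynomial.C 1) ^ ordOne F * jPoly F = clearedPoly F :=
  Polynomial.pow_mul_divByMonic_rootMultiplicity_eq _ _

lemma eval_one_jPoly_ne_zero {F : ℤ[T;T⁻¹]} (hF : F ≠ 0) : (jPoly F).eval 1 ≠ 0 :=
  Polynomial.eval_divByMonic_pow_rootMultiplicity_ne_zero _ (clearedPoly_ne_zero hF)

lemma jPoly_ne_zero {F : ℤ[T;T⁻¹]} (hF : F ≠ 0) : jPoly F ≠ 0 := by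
  intro h
  exact eval_one_jPoly_ne_zero hF (by rw [h, Polynomial.eval_zero])

lemma pierceLehmer_one (f : ℤ[X]) : |pierceLehmer f 1| = |f.eval 1| := by
  have h : (Polynomial.X ^ 1 - 1 : ℤ[X]) = Polynomial.X - Polynomial.C 1 := by simp
  rw [pierceLehmer, h, Polynomial.natDegree_X_sub_C, Polynomial.resultant_X_sub_C_right _ _ _ le_rfl]
  simp [abs_mul, abs_pow]

/-! ### Products over roots of unity -/

lemma exists_primitive_char [IsAlgClosed K] [CharZero K] (n : ℕ) [NeZero n] :
    ∃ ψ : AddChar (ZMod n) K, ψ.IsPrimitive ∧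
      ∏ k, (Polynomial.X - Polynomial.C (ψ k)) = (Polynomial.X ^ n - 1 : K[X]) := by
  have : NeZero (n : K) := ⟨Nat.cast_ne_zero.2 (NeZero.ne n)⟩
  obtain ⟨ζ, hζ⟩ := IsAlgClosed.exists_root (Polynomial.cyclotomic n K) (by
    rw [Polynomial.degree_cyclotomic]
    exact_mod_cast (Nat.totient_pos.2 (NeZero.pos n)).ne')
  rw [Polynomial.isRoot_cyclotomic_iff] at hζ
  refine ⟨_, AddChar.zmodChar_primitive_of_primitive_root n hζ, ?_⟩
  classical
  rw [Polynomial.X_pow_sub_one_eq_prod (NeZero.pos n) hζ]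
  have hinj : Function.Injective (AddChar.zmodChar n ((IsPrimitiveRoot.iff_def ζ n).mp hζ).left) := by
    intro a b hab
    rw [AddChar.zmodChar_apply, AddChar.zmodChar_apply] at hab
    exact ZMod.val_injective n (hζ.pow_inj (ZMod.val_lt a) (ZMod.val_lt b) hab)
  rw [← Finset.prod_image (s := Finset.univ)
    (g := AddChar.zmodChar n ((IsPrimitiveRoot.iff_def ζ n).mp hζ).left)
    (f := fun ζ => Polynomial.X - Polynomial.C ζ) hinj.injOn]
  refine Finset.prod_congr (Finset.eq_of_subset_of_card_le ?_ ?_) fun _ _ => rfl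
  · intro x hx
    obtain ⟨a, -, rfl⟩ := Finset.mem_image.1 hx
    rw [Polynomial.mem_nthRootsFinset (NeZero.pos n), AddChar.zmodChar_apply, ← pow_mul, mul_comm,
      pow_mul, hζ.pow_eq_one, one_pow]
  · rw [hζ.card_nthRootsFinset, Finset.card_image_of_injective _ hinj, Finset.card_univ, ZMod.card]

section

variable {n : ℕ} [NeZero n] {ψ : AddChar (ZMod n) K}

lemma prod_sub_char
    (hψ : ∏ k, (Polynomial.X - Polynomial.C (ψ k)) = (Polynomial.X ^ n - 1 : K[X])) (x : K) :
    ∏ k, (x - ψ k) = x ^ n - 1 := by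
  have := congrArg (Polynomial.eval x) hψ
  simpa [Polynomial.eval_prod] using this

/-- Cancel the factor `X - 1` of `X ^ n - 1` and evaluate `1 + X + ⋯ + X ^ (n - 1)` at `1`. -/
lemma prod_one_sub_char
    (hψ : ∏ k, (Polynomial.X - Polynomial.C (ψ k)) = (Polynomial.X ^ n - 1 : K[X])) :
    ∏ k ∈ Finset.univ.erase (0 : ZMod n), (1 - ψ k) = n := by
  have h : ∏ k ∈ Finset.univ.erase (0 : ZMod n), (Polynomial.X - Polynomial.C (ψ k)) =
      ∑ i ∈ Finset.range n, (Polynomial.X ^ i : K[X]) := by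
    refine mul_left_cancel₀ (Polynomial.X_sub_C_ne_zero (1 : K)) ?_
    have h1 := Finset.mul_prod_erase Finset.univ (fun k => Polynomial.X - Polynomial.C (ψ k))
      (Finset.mem_univ 0)
    rw [AddChar.map_zero_eq_one] at h1
    rw [h1, hψ, Polynomial.C_1, mul_geom_sum]
  have := congrArg (Polynomial.eval 1) h
  simpa [Polynomial.eval_prod, Polynomial.eval_finsetSum] using this

end

end IharaTower

/-! ### The Ihara polynomial of a connected tower, and the norm of the number of spanning trees -/

namespace SerreGraph

open IharaTower

variable {V E : Type*} [Fintype V] [DecidableEq V] [Fintype E]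

/-- The value of the Ihara polynomial at the nontrivial square root of unity is a factor of `2
κ(X_2)`, which is nonzero because `X_2` is connected. -/
lemma iharaPoly_ne_zero [Nonempty V] (X : SerreGraph V E) (α : X.Voltage ℤ)
    (hα : ∀ n : ℕ, 1 ≤ n → (X.layer α n).Connected) : X.iharaPoly α ≠ 0 := by
  obtain ⟨ψ, hψ, -⟩ := exists_primitive_char (K := ℂ) 2
  intro h0
  have h1 := natCast_mul_kappa_layer hψ X α
  have h2 : (X.lapAt α (ψ 1)).det = 0 := by
    have h3 := X.eval_iharaPoly α (ψ.val_isUnit 1).unit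
    rw [h0, map_zero] at h3
    exact h3.symm
  rw [Finset.prod_eq_zero (Finset.mem_erase.2 ⟨by decide, Finset.mem_univ (1 : ZMod 2)⟩) h2,
    mul_zero] at h1
  have h4 := kappa_ne_zero (X.layer α 2) (hα 2 (by norm_num))
  simp [h4] at h1

/-- At `t = 1` the matrix is the ordinary Laplacian, which kills constant vectors. This is what
makes `λ_p` nonnegative. -/
lemma ordOne_pos [Nonempty V] (X : SerreGraph V E) (α : X.Voltage ℤ)
    (hI : X.iharaPoly α ≠ 0) : 0 < ordOne (X.iharaPoly α) := by
  rw [ordOne, Polynomial.rootMultiplicity_pos (clearedPoly_ne_zero hI), Polynomial.IsRoot.def]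
  have h1 := eval_clearedPoly (K := ℚ) (X.iharaPoly α) 1
  have h2 : (X.lap ℚ).det = 0 := by
    rw [← Matrix.exists_mulVec_eq_zero_iff]
    refine ⟨fun _ => 1, Function.ne_iff.2 ⟨Classical.arbitrary V, one_ne_zero⟩, ?_⟩
    ext v
    simp [Matrix.mulVec, dotProduct, X.sum_lap_row]
  rw [eval_iharaPoly, Units.val_one, lapAt_one, h2, mul_zero] at h1
  have h3 := Polynomial.hom_eval₂ (clearedPoly (X.iharaPoly α)) (RingHom.id ℤ) (Int.castRingHom ℚ) 1
  rw [RingHom.comp_id, map_one, h1] at h3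
  exact (RingHom.injective_int (Int.castRingHom ℚ)) (h3.trans (map_zero _).symm)

variable {K : Type*} [NormedField K]

lemma norm_char_eq_one {n : ℕ} [NeZero n] (ψ : AddChar (ZMod n) K) (k : ZMod n) : ‖ψ k‖ = 1 := by
  refine (pow_eq_one_iff_of_nonneg (norm_nonneg _) (NeZero.ne n)).1 ?_
  rw [← norm_pow, ← AddChar.map_nsmul_eq_pow]
  simp

/-- The absolute value of the number of spanning trees of the layers. -/
theorem norm_kappa_layer [IsAlgClosed K] [CharZero K] [Nonempty V] (X : SerreGraph V E)
    (α : X.Voltage ℤ) (n : ℕ) [NeZero n] :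
    ‖(n : K)‖ * ‖((X.layer α n).kappa : K)‖ * ‖(((jPoly (X.iharaPoly α)).eval 1 : ℤ) : K)‖ =
      ‖(X.kappa : K)‖ * ‖(n : K)‖ ^ ordOne (X.iharaPoly α) *
        (‖((jPoly (X.iharaPoly α)).leadingCoeff : K)‖ ^ n *
          (((jPoly (X.iharaPoly α)).map (Int.castRingHom K)).roots.map fun β => ‖β ^ n - 1‖).prod) := by
  obtain ⟨ψ, hψ, hprod⟩ := exists_primitive_char (K := K) n
  have h1 := natCast_mul_kappa_layer hψ X α
  set J := jPoly (X.iharaPoly α) with hJ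
  set e := ordOne (X.iharaPoly α) with he
  -- The power of `t` separating `F` from `clearedPoly F` has norm `1` at a root of unity.
  have hval : ∀ k, ‖(X.lapAt α (ψ k)).det‖ =
      ‖1 - ψ k‖ ^ e * ‖J.eval₂ (Int.castRingHom K) (ψ k)‖ := by
    intro k
    have h2 := X.eval_iharaPoly α (ψ.val_isUnit k).unit
    have h3 := eval_clearedPoly (X.iharaPoly α) (ψ.val_isUnit k).unit
    rw [h2, IsUnit.unit_spec, ← pow_mul_jPoly, Polynomial.eval₂_mul] at h3
    have h4 := congrArg norm h3
    rw [norm_mul, norm_mul, norm_zpow, norm_char_eq_one, one_zpow, one_mul] at h4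
    rw [← h4]
    congr 1
    simp [Polynomial.eval₂_pow, norm_sub_rev, he]
  have hall : ∏ k, ‖J.eval₂ (Int.castRingHom K) (ψ k)‖ =
      ‖(J.leadingCoeff : K)‖ ^ n * ((J.map (Int.castRingHom K)).roots.map fun β => ‖β ^ n - 1‖).prod := by
    have h2 : ∀ k, ‖J.eval₂ (Int.castRingHom K) (ψ k)‖ =
        ‖(J.leadingCoeff : K)‖ * ((J.map (Int.castRingHom K)).roots.map fun β => ‖β - ψ k‖).prod := by
      intro k
      have h3 := (IsAlgClosed.splits (J.map (Int.castRingHom K))).eval_eq_prod_roots (ψ k)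
      rw [Polynomial.leadingCoeff_map_of_injective (RingHom.injective_int (Int.castRingHom K)),
        Polynomial.eval_map] at h3
      rw [h3, norm_mul]
      congr 1
      refine (Multiset.prod_hom _ (normHom (α := K))).symm.trans ?_
      rw [Multiset.map_map]
      exact congrArg _ (Multiset.map_congr rfl fun β _ => norm_sub_rev (ψ k) β)
    rw [Finset.prod_congr rfl fun k _ => h2 k, Finset.prod_mul_distrib, Finset.prod_const,
      Finset.card_univ, ZMod.card, Finset.prod_eq_multiset_prod, Multiset.prod_map_prod_map]
    congr 2
    refine Multiset.map_congr rfl fun β _ => ?_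
    rw [← prod_sub_char hprod, norm_prod]
    rfl
  have h5 := congrArg norm h1
  rw [norm_mul, norm_mul, norm_prod, Finset.prod_congr rfl fun k _ => hval k,
    Finset.prod_mul_distrib, Finset.prod_pow, ← norm_prod, prod_one_sub_char hprod] at h5
  -- The product over all `k` has one factor too many, `|J(1)|` at `k = 0`; this is why it appears
  -- on the left-hand side.
  have h6 := Finset.mul_prod_erase Finset.univ (fun k => ‖J.eval₂ (Int.castRingHom K) (ψ k)‖)
    (Finset.mem_univ 0)
  have h7 : J.eval₂ (Int.castRingHom K) (ψ 0) = ((J.eval 1 : ℤ) : K) := by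
    rw [AddChar.map_zero_eq_one]
    have h3 := Polynomial.hom_eval₂ J (RingHom.id ℤ) (Int.castRingHom K) 1
    rw [RingHom.comp_id, map_one] at h3
    exact h3.symm
  rw [h5, ← hall, ← h6, h7]
  ring

end SerreGraph

/-! ### Powers of principal units -/

namespace IsUltrametricDist

variable {K : Type*} [NormedField K] [IsUltrametricDist K]

lemma norm_sub_le_max' (x y : K) : ‖x - y‖ ≤ max ‖x‖ ‖y‖ := by
  rw [sub_eq_add_neg, ← norm_neg y]
  exact norm_add_le_max x (-y)

lemma norm_eq_one_of_sub_one_lt {u : K} (hu : ‖u - 1‖ < 1) : ‖u‖ = 1 := by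
  have h := norm_add_eq_max_of_norm_ne_norm (x := u - 1) (y := 1) (by rw [norm_one]; exact hu.ne)
  rwa [sub_add_cancel, norm_one, max_eq_right hu.le] at h

lemma norm_pow_sub_one_le {u : K} (hu : ‖u - 1‖ < 1) (k : ℕ) : ‖u ^ k - 1‖ ≤ ‖u - 1‖ := by
  rw [← geom_sum_mul, norm_mul]
  refine mul_le_of_le_one_left (norm_nonneg _) (norm_sum_le_of_forall_le_of_nonneg zero_le_one ?_)
  intro i _
  rw [norm_pow, norm_eq_one_of_sub_one_lt hu, one_pow]

/-- In `u ^ k - 1 = (1 + u + ⋯ + u ^ (k - 1)) (u - 1)` the first factor is congruent to the unit `k`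
modulo the maximal ideal. -/
lemma norm_pow_sub_one_eq {u : K} (hu : ‖u - 1‖ < 1) {k : ℕ} (hk : ‖(k : K)‖ = 1) :
    ‖u ^ k - 1‖ = ‖u - 1‖ := by
  rw [← geom_sum_mul, norm_mul]
  have h1 : ∑ i ∈ Finset.range k, u ^ i = ∑ i ∈ Finset.range k, (u ^ i - 1) + k := by
    simp
  have h2 : ‖∑ i ∈ Finset.range k, (u ^ i - 1)‖ < 1 :=
    (norm_sum_le_of_forall_le_of_nonneg (norm_nonneg _)
      fun i _ => norm_pow_sub_one_le hu i).trans_lt hu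
  rw [h1, norm_add_eq_max_of_norm_ne_norm (by rw [hk]; exact h2.ne), hk, max_eq_right h2.le, one_mul]

variable {p : ℕ}

/-- Expand `((u - 1) + 1) ^ p`: the inner binomial coefficients are divisible by `p`. After `p (u -
1)` is taken out, the term `k = 1` of `S` is `1` and the others are divisible by `u - 1`. -/
lemma exists_pow_prime_sub_one_eq (hp : p.Prime) {u : K} (hu : ‖u - 1‖ < 1) :
    ∃ S : K, ‖S‖ = 1 ∧ u ^ p - 1 = (u - 1) ^ p + p * (u - 1) * S := by
  refine ⟨∑ k ∈ Finset.Ioo 0 p, (u - 1) ^ (k - 1) * 1 ^ (p - k - 1) * ↑(p.choose k / p), ?_, ?_⟩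
  · apply norm_eq_one_of_sub_one_lt
    have h1 : 1 ∈ Finset.Ioo 0 p := Finset.mem_Ioo.2 ⟨one_pos, hp.one_lt⟩
    rw [← Finset.add_sum_erase _ _ h1]
    have h2 : (u - 1) ^ (1 - 1) * 1 ^ (p - 1 - 1) * ((p.choose 1 / p : ℕ) : K) = 1 := by
      simp [Nat.div_self hp.pos]
    rw [h2, add_sub_cancel_left]
    refine (norm_sum_le_of_forall_le_of_nonneg (norm_nonneg (u - 1)) ?_).trans_lt hu
    intro k hk
    rw [Finset.mem_erase, Finset.mem_Ioo] at hk
    rw [one_pow, mul_one, norm_mul, norm_pow]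
    refine (mul_le_of_le_one_right (by positivity) (norm_natCast_le_one _ _)).trans ?_
    exact pow_le_of_le_one (norm_nonneg _) hu.le (by omega)
  · have h := add_pow_prime_eq hp (u - 1) 1
    rw [sub_add_cancel, mul_one, one_pow] at h
    rw [h]
    ring

lemma norm_pow_prime_sub_one_le (hp : p.Prime) {u : K} (hu : ‖u - 1‖ < 1) :
    ‖u ^ p - 1‖ ≤ max (‖u - 1‖ ^ p) (‖(p : K)‖ * ‖u - 1‖) := by
  obtain ⟨S, hS, h⟩ := exists_pow_prime_sub_one_eq hp hu
  rw [h]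
  refine (norm_add_le_max _ _).trans_eq ?_
  rw [norm_pow, norm_mul, norm_mul, hS, mul_one]

/-- The hypothesis says that the linear term `p (u - 1)` strictly dominates `(u - 1) ^ p`. -/
lemma norm_pow_prime_sub_one_eq (hp : p.Prime) {u : K} (hu : ‖u - 1‖ < 1)
    (h : ‖u - 1‖ ^ (p - 1) < ‖(p : K)‖) : ‖u ^ p - 1‖ = ‖(p : K)‖ * ‖u - 1‖ := by
  obtain ⟨S, hS, h1⟩ := exists_pow_prime_sub_one_eq hp hu
  by_cases h0 : u = 1
  · simp [h0]
  have hpos : 0 < ‖u - 1‖ := norm_pos_iff.2 (sub_ne_zero.2 h0)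
  have h2 : ‖(u - 1) ^ p‖ < ‖(p : K) * (u - 1) * S‖ := by
    rw [norm_pow, norm_mul, norm_mul, hS, mul_one, ← pow_sub_one_mul hp.ne_zero]
    exact mul_lt_mul_of_pos_right h hpos
  rw [h1, norm_add_eq_max_of_norm_ne_norm h2.ne, max_eq_right h2.le, norm_mul, norm_mul, hS, mul_one]

lemma norm_pow_prime_pow_sub_one_eq (hp : p.Prime) {u : K} (hu : ‖u - 1‖ < 1)
    (h : ‖u - 1‖ ^ (p - 1) < ‖(p : K)‖) (k : ℕ) :
    ‖u ^ p ^ k - 1‖ = ‖(p : K)‖ ^ k * ‖u - 1‖ := by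
  induction k with
  | zero => simp
  | succ k ih =>
    have hle := norm_pow_sub_one_le hu (p ^ k)
    rw [pow_succ, pow_mul, norm_pow_prime_sub_one_eq hp (hle.trans_lt hu), ih]
    · ring
    · exact (pow_le_pow_left₀ (norm_nonneg _) hle _).trans_lt h

/-- As long as the linear term does not dominate, each `p`-th power raises the bound on the distance
to `1` to the power `p`; once it dominates, it does so forever. -/
lemma norm_pow_prime_pow_sub_one_le_or (hp : p.Prime) {u : K} (hu : ‖u - 1‖ < 1) (k : ℕ) :
    ‖u ^ p ^ k - 1‖ ^ (p - 1) < ‖(p : K)‖ ∨ ‖u ^ p ^ k - 1‖ ≤ ‖u - 1‖ ^ p ^ k := by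
  induction k with
  | zero => simp
  | succ k ih =>
    have hle := norm_pow_sub_one_le hu (p ^ k)
    have hu' := hle.trans_lt hu
    rcases lt_or_ge (‖u ^ p ^ k - 1‖ ^ (p - 1)) ‖(p : K)‖ with h | h
    · left
      have h1 := norm_pow_sub_one_le hu' p
      rw [← pow_mul, ← pow_succ] at h1
      exact (pow_le_pow_left₀ (norm_nonneg _) h1 _).trans_lt h
    · right
      have h1 := ih.resolve_left h.not_gt
      have h2 := norm_pow_prime_sub_one_le hp hu'
      rw [max_eq_left, ← pow_mul, ← pow_succ] at h2
      · refine h2.trans ((pow_le_pow_left₀ (norm_nonneg _) h1 _).trans_eq ?_)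
        rw [← pow_mul, ← pow_succ]
      · rw [← pow_sub_one_mul hp.ne_zero ‖u ^ p ^ k - 1‖]
        exact mul_le_mul_of_nonneg_right h (norm_nonneg _)

/-- From the level `s` on, raising to the power `p` multiplies the distance to `1` by `‖p‖`. -/
lemma norm_pow_prime_pow_sub_one (hp : p.Prime) {u : K} (hu : ‖u - 1‖ < 1) {s : ℕ}
    (hs : ‖u - 1‖ ^ (p ^ s * (p - 1)) < ‖(p : K)‖) (k : ℕ) :
    ‖u ^ p ^ k - 1‖ = ‖(p : K)‖ ^ (k - min k s) * ‖u ^ p ^ min k s - 1‖ := by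
  rcases le_total k s with h | h
  · simp [min_eq_left h]
  · rw [min_eq_right h]
    have hs' : ‖u ^ p ^ s - 1‖ ^ (p - 1) < ‖(p : K)‖ := by
      rcases norm_pow_prime_pow_sub_one_le_or hp hu s with h1 | h1
      · exact h1
      · refine (pow_le_pow_left₀ (norm_nonneg _) h1 _).trans_lt ?_
        rwa [← pow_mul]
    have h2 := norm_pow_prime_pow_sub_one_eq hp ((norm_pow_sub_one_le hu _).trans_lt hu) hs' (k - s)
    rwa [← pow_mul, ← pow_add, Nat.add_sub_cancel' h] at h2

end IsUltrametricDist

namespace IharaTower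

/-! ### Reduction and Teichmüller lifts -/

variable (p : ℕ) [Fact p.Prime]

lemma mem_algClInt {x : PadicAlgCl p} : x ∈ algClInt p ↔ ‖x‖ ≤ 1 := Iff.rfl

variable {p}

lemma reduction_of_norm_le {x : PadicAlgCl p} (hx : ‖x‖ ≤ 1) :
    reduction p x = IsLocalRing.residue (algClInt p) ⟨x, hx⟩ := dif_pos hx

lemma residue_eq_zero_iff {x : algClInt p} :
    IsLocalRing.residue (algClInt p) x = 0 ↔ ‖(x : PadicAlgCl p)‖ < 1 := by
  rw [IsLocalRing.residue_eq_zero_iff, IsLocalRing.mem_maximalIdeal, mem_nonunits_iff]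
  have hx : ‖(x : PadicAlgCl p)‖ ≤ 1 := x.2
  rw [← not_iff_comm, not_lt]
  constructor
  · intro h
    have h1 : ‖(x : PadicAlgCl p)‖ = 1 := le_antisymm hx h
    have h0 : (x : PadicAlgCl p) ≠ 0 := fun h0 => by simp [h0] at h1
    refine IsUnit.of_mul_eq_one ⟨(x : PadicAlgCl p)⁻¹, ?_⟩ (Subtype.ext (mul_inv_cancel₀ h0))
    rw [mem_algClInt, norm_inv, h1, inv_one]
  · rintro ⟨u, rfl⟩
    have h1 : ((u : algClInt p) : PadicAlgCl p) * ((u⁻¹ : (algClInt p)ˣ) : algClInt p) = 1 :=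
      congrArg Subtype.val u.mul_inv
    have h2 := congrArg norm h1
    rw [norm_mul, norm_one] at h2
    have h3 : ‖(((u⁻¹ : (algClInt p)ˣ) : algClInt p) : PadicAlgCl p)‖ ≤ 1 :=
      ((u⁻¹ : (algClInt p)ˣ) : algClInt p).2
    nlinarith [norm_nonneg (((u : algClInt p) : PadicAlgCl p))]

lemma reduction_eq_iff {x y : PadicAlgCl p} (hx : ‖x‖ ≤ 1) (hy : ‖y‖ ≤ 1) :
    reduction p x = reduction p y ↔ ‖x - y‖ < 1 := by
  rw [reduction_of_norm_le hx, reduction_of_norm_le hy, ← sub_eq_zero, ← map_sub,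
    residue_eq_zero_iff]
  rfl

lemma reduction_pow {x : PadicAlgCl p} (hx : ‖x‖ ≤ 1) (n : ℕ) :
    reduction p (x ^ n) = reduction p x ^ n := by
  have h : ‖x ^ n‖ ≤ 1 := by rw [norm_pow]; exact pow_le_one₀ (norm_nonneg _) hx
  rw [reduction_of_norm_le hx, reduction_of_norm_le h, ← map_pow]
  rfl

lemma reduction_one : reduction p (1 : PadicAlgCl p) = 1 := by
  rw [reduction_of_norm_le norm_one.le]
  exact map_one _

lemma norm_eq_one_of_pow_eq_one {K : Type*} [NormedField K] {ξ : K} {k : ℕ} (hk : k ≠ 0)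
    (h : ξ ^ k = 1) : ‖ξ‖ = 1 := by
  refine (pow_eq_one_iff_of_nonneg (norm_nonneg _) hk).1 ?_
  rw [← norm_pow, h, norm_one]

lemma norm_natCast_p : ‖(p : PadicAlgCl p)‖ = (p : ℝ)⁻¹ := by
  have h := PadicAlgCl.norm_extends p (p : ℚ_[p])
  rwa [Padic.norm_p, map_natCast] at h

lemma norm_intCast (z : ℤ) : ‖(z : PadicAlgCl p)‖ = ‖(z : ℚ_[p])‖ := by
  have h := PadicAlgCl.norm_extends p (z : ℚ_[p])
  rwa [map_intCast] at h

lemma norm_natCast (n : ℕ) : ‖(n : PadicAlgCl p)‖ = ‖(n : ℚ_[p])‖ := by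
  exact_mod_cast norm_intCast (p := p) n

lemma norm_natCast_eq_one {k : ℕ} (hk : k.Coprime p) : ‖(k : PadicAlgCl p)‖ = 1 := by
  rw [norm_natCast, Padic.norm_natCast_eq_one_iff]
  exact hk.symm

lemma ne_zero_of_coprime {k : ℕ} (hk : k.Coprime p) : k ≠ 0 := by
  rintro rfl
  exact (Fact.out : p.Prime).ne_one ((Nat.coprime_zero_left p).1 hk)

instance : CharP (IsLocalRing.ResidueField (algClInt p)) p := by
  refine (CharP.charP_iff_prime_eq_zero Fact.out).2 ?_
  rw [← map_natCast (IsLocalRing.residue (algClInt p)), residue_eq_zero_iff]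
  have h : ((p : algClInt p) : PadicAlgCl p) = (p : PadicAlgCl p) := by norm_cast
  rw [h, norm_natCast_p]
  exact inv_lt_one_of_one_lt₀ (by exact_mod_cast (Fact.out : p.Prime).one_lt)

/-- The reduction of an integral zero of a nonzero integer polynomial is algebraic over the prime
field. -/
lemma isAlgebraic_reduction {f : ℤ[X]} (hf : f ≠ 0) {β : PadicAlgCl p} (hβ : ‖β‖ ≤ 1)
    (h : f.aeval β = 0) : letI := ZMod.algebra (IsLocalRing.ResidueField (algClInt p)) p
    IsAlgebraic (ZMod p) (reduction p β) := by
  let := ZMod.algebra (IsLocalRing.ResidueField (algClInt p)) p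
  -- Dividing out the content guarantees a nonzero polynomial modulo `p`.
  have h1 : f.primPart.aeval β = 0 := by
    rw [f.eq_C_content_mul_primPart, map_mul, Polynomial.aeval_C, mul_eq_zero] at h
    refine h.resolve_left ?_
    simpa [Polynomial.content_eq_zero_iff] using hf
  refine ⟨f.primPart.map (Int.castRingHom (ZMod p)), ?_, ?_⟩
  · intro h0
    have h2 : Polynomial.C (p : ℤ) ∣ f.primPart := by
      rw [Polynomial.C_dvd_iff_dvd_coeff]
      intro i
      have := congrArg (fun q => q.coeff i) h0
      simp only [Polynomial.coeff_map, eq_intCast, Polynomial.coeff_zero] at this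
      exact (ZMod.intCast_zmod_eq_zero_iff_dvd _ _).1 this
    have h3 := f.isPrimitive_primPart _ h2
    exact (Nat.prime_iff_prime_int.1 Fact.out).not_isUnit h3
  · have h2 : f.primPart.aeval (⟨β, hβ⟩ : algClInt p) = 0 := by
      apply Subtype.val_injective
      have := Polynomial.hom_eval₂ f.primPart (algebraMap ℤ (algClInt p)) (algClInt p).subtype ⟨β, hβ⟩
      rw [RingHom.ext_int ((algClInt p).subtype.comp (algebraMap ℤ (algClInt p)))
        (algebraMap ℤ (PadicAlgCl p))] at this
      exact this.trans h1
    have h3 := Polynomial.hom_eval₂ f.primPart (algebraMap ℤ (algClInt p))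
      (IsLocalRing.residue (algClInt p)) ⟨β, hβ⟩
    rw [← Polynomial.aeval_def, h2, map_zero, ← reduction_of_norm_le hβ] at h3
    rw [Polynomial.aeval_def, Polynomial.eval₂_map, h3]
    congr 1
    exact RingHom.ext_int _ _

/-- The reduction is algebraic over `ZMod p`, so it generates a finite ring, and two of its powers
coincide. Positivity excludes the default value `0` of `orderOf`. -/
lemma residueOrder_pos {f : ℤ[X]} (hf : f ≠ 0) {β : PadicAlgCl p} (hβ : ‖β‖ = 1)
    (h : f.aeval β = 0) : 0 < residueOrder p β := by
  let := ZMod.algebra (IsLocalRing.ResidueField (algClInt p)) p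
  have halg := isAlgebraic_reduction hf hβ.le h
  have hint := halg.isIntegral
  have hfin : Module.Finite (ZMod p) (Algebra.adjoin (ZMod p) {reduction p β}) :=
    Algebra.finite_adjoin_simple_of_isIntegral hint
  have hfin2 : Finite (Algebra.adjoin (ZMod p) {reduction p β}) :=
    Module.finite_of_finite (ZMod p)
  have hne : reduction p β ≠ 0 := by
    rw [reduction_of_norm_le hβ.le, Ne, residue_eq_zero_iff, not_lt]
    exact hβ.ge
  set x : Algebra.adjoin (ZMod p) {reduction p β} :=
    ⟨reduction p β, Algebra.self_mem_adjoin_singleton _ _⟩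
  obtain ⟨a, b, hab, hxab⟩ := Finite.exists_ne_map_eq_of_infinite fun k : ℕ => x ^ k
  have key : ∀ a b : ℕ, a < b → x ^ a = x ^ b → 0 < residueOrder p β := by
    intro a b hlt hxab
    have h1 : reduction p β ^ a = reduction p β ^ b := congrArg Subtype.val hxab
    rw [residueOrder, orderOf_pos_iff, isOfFinOrder_iff_pow_eq_one]
    refine ⟨b - a, by omega, mul_left_cancel₀ (pow_ne_zero a hne) ?_⟩
    rw [← pow_add, mul_one, h1]
    congr 1
    omega
  rcases lt_or_gt_of_ne hab with hlt | hlt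
  · exact key a b hlt hxab
  · exact key b a hlt hxab.symm

/-- Frobenius is injective on the residue field, so there is no nontrivial `p`-th root of unity. -/
lemma residueOrder_coprime {β : PadicAlgCl p} (h : 0 < residueOrder p β) :
    (residueOrder p β).Coprime p := by
  rw [Nat.coprime_comm, (Fact.out : p.Prime).coprime_iff_not_dvd]
  rintro ⟨m, hm⟩
  have h1 : (reduction p β ^ m) ^ p = 1 := by
    rw [← pow_mul, mul_comm, ← hm]
    exact pow_orderOf_eq_one _
  have h2 : reduction p β ^ m = 1 := frobenius_inj _ p (by rw [frobenius_def, h1, map_one])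
  have h3 : residueOrder p β ≤ m :=
    orderOf_le_of_pow_eq_one (Nat.pos_of_ne_zero fun h0 => by simp [h0] at hm; omega) h2
  have h4 := (Fact.out : p.Prime).two_le
  nlinarith

/-- Reduce `∏ (X - ψ k) = X ^ N - 1` modulo the maximal ideal and evaluate at the reduction of `β`:
some factor vanishes. -/
lemma exists_teichmuller {β : PadicAlgCl p} (h : 0 < residueOrder p β) :
    ∃ ξ : PadicAlgCl p, (∃ k : ℕ, k.Coprime p ∧ ξ ^ k = 1) ∧ reduction p ξ = reduction p β := by
  set N := residueOrder p β
  have : NeZero N := ⟨h.ne'⟩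
  obtain ⟨ψ, -, hψ⟩ := exists_primitive_char (K := PadicAlgCl p) N
  have hroot : ∀ k, ψ k ^ N = 1 := fun k => by
    rw [← AddChar.map_nsmul_eq_pow]
    simp
  have hle : ∀ k, ‖ψ k‖ ≤ 1 := fun k => (norm_eq_one_of_pow_eq_one h.ne' (hroot k)).le
  have h1 : ∏ k, (Polynomial.X - Polynomial.C (⟨ψ k, hle k⟩ : algClInt p)) =
      (Polynomial.X ^ N - 1 : (algClInt p)[X]) := by
    apply Polynomial.map_injective (algClInt p).subtype Subtype.val_injective
    rw [Polynomial.map_prod]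
    simpa using hψ
  have h2 := congrArg (Polynomial.eval₂ (IsLocalRing.residue (algClInt p)) (reduction p β)) h1
  rw [Polynomial.eval₂_finsetProd] at h2
  have h3 : reduction p β ^ N = 1 := pow_orderOf_eq_one _
  simp only [Polynomial.eval₂_sub, Polynomial.eval₂_X, Polynomial.eval₂_C, Polynomial.eval₂_pow,
    Polynomial.eval₂_one, h3, sub_self] at h2
  obtain ⟨k, -, hk⟩ := Finset.prod_eq_zero_iff.1 h2
  refine ⟨ψ k, ⟨N, residueOrder_coprime h, hroot k⟩, ?_⟩
  rw [reduction_of_norm_le (hle k), eq_comm, ← sub_eq_zero, hk]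

lemma teichmuller_spec {β : PadicAlgCl p} (h : 0 < residueOrder p β) :
    (∃ k : ℕ, k.Coprime p ∧ teichmuller p (reduction p β) ^ k = 1) ∧
      reduction p (teichmuller p (reduction p β)) = reduction p β := by
  have hex := exists_teichmuller h
  rw [teichmuller, dif_pos hex]
  exact hex.choose_spec

lemma norm_teichmuller {β : PadicAlgCl p} (h : 0 < residueOrder p β) :
    ‖teichmuller p (reduction p β)‖ = 1 := by
  obtain ⟨⟨k, hk, hk1⟩, -⟩ := teichmuller_spec h
  exact norm_eq_one_of_pow_eq_one (ne_zero_of_coprime hk) hk1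

/-- `τ ^ N` is a principal unit killed by an exponent `k` prime to `p`. Since raising to the power
`k` preserves the distance to `1`, it equals `1`. -/
lemma teichmuller_pow_residueOrder {β : PadicAlgCl p} (h : 0 < residueOrder p β) :
    teichmuller p (reduction p β) ^ residueOrder p β = 1 := by
  obtain ⟨⟨k, hk, hk1⟩, hred⟩ := teichmuller_spec h
  set τ := teichmuller p (reduction p β)
  have hτ : ‖τ‖ ≤ 1 := (norm_teichmuller h).le
  have h1 : ‖τ ^ residueOrder p β - 1‖ < 1 := by
    rw [← reduction_eq_iff (by rw [norm_pow]; exact pow_le_one₀ (norm_nonneg _) hτ) norm_one.le,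
      reduction_pow hτ, hred, reduction_one]
    exact pow_orderOf_eq_one _
  have h2 := IsUltrametricDist.norm_pow_sub_one_eq h1 (norm_natCast_eq_one hk)
  rw [← pow_mul, mul_comm, pow_mul, hk1, one_pow, sub_self, norm_zero] at h2
  exact sub_eq_zero.1 (norm_eq_zero.1 h2.symm)

/-! ### The absolute value of `β ^ n - 1` -/

lemma norm_pow_sub_one_of_not_dvd {β : PadicAlgCl p} (hβ : ‖β‖ = 1) {n : ℕ}
    (hn : ¬ residueOrder p β ∣ n) : ‖β ^ n - 1‖ = 1 := by
  have hle : ‖β ^ n‖ ≤ 1 := by rw [norm_pow, hβ, one_pow]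
  refine le_antisymm ?_ (not_lt.1 fun h => hn ?_)
  · refine (IsUltrametricDist.norm_sub_le_max' _ _).trans ?_
    rw [norm_one]
    exact max_le hle le_rfl
  · rw [← reduction_eq_iff hle norm_one.le, reduction_pow hβ.le, reduction_one] at h
    exact orderOf_dvd_of_pow_eq_one h

lemma ordP_mul {x y : PadicAlgCl p} (hx : x ≠ 0) (hy : y ≠ 0) :
    ordP p (x * y) = ordP p x + ordP p y := by
  rw [ordP, ordP, ordP, norm_mul, Real.log_mul (norm_ne_zero_iff.2 hx) (norm_ne_zero_iff.2 hy)]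
  ring

lemma log_p_pos : 0 < Real.log p :=
  Real.log_pos (by exact_mod_cast (Fact.out : p.Prime).one_lt)

lemma ordP_natCast_p : ordP p (p : PadicAlgCl p) = 1 := by
  rw [ordP, norm_natCast_p, Real.log_inv, neg_neg, div_self log_p_pos.ne']

lemma ordP_congr {x y : PadicAlgCl p} (h : ‖x‖ = ‖y‖) : ordP p x = ordP p y := by
  rw [ordP, ordP, h]

lemma ordP_pow (x : PadicAlgCl p) (k : ℕ) : ordP p (x ^ k) = k * ordP p x := by
  rw [ordP, ordP, norm_pow, Real.log_pow]
  ring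

lemma one_lt_ordP_iff {x : PadicAlgCl p} (hx : x ≠ 0) : 1 < ordP p x ↔ ‖x‖ < ‖(p : PadicAlgCl p)‖ := by
  have hp : (p : PadicAlgCl p) ≠ 0 := Nat.cast_ne_zero.2 (Fact.out : p.Prime).ne_zero
  rw [← Real.log_lt_log_iff (norm_pos_iff.2 hx) (norm_pos_iff.2 hp), norm_natCast_p, Real.log_inv,
    ordP, lt_div_iff₀ log_p_pos, one_mul, lt_neg]

lemma ordP_pos {x : PadicAlgCl p} (hx : x ≠ 0) (h : ‖x‖ < 1) : 0 < ordP p x :=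
  div_pos (neg_pos.2 (Real.log_neg (norm_pos_iff.2 hx) h)) log_p_pos

/-- The defining property of `s_p(β)`. -/
lemma sInv_spec {β : PadicAlgCl p} (h0 : β - teichmuller p (reduction p β) ≠ 0)
    (h1 : ‖β - teichmuller p (reduction p β)‖ < 1) :
    ‖β - teichmuller p (reduction p β)‖ ^ (p ^ sInv p β * (p - 1)) < ‖(p : PadicAlgCl p)‖ := by
  set y := β - teichmuller p (reduction p β)
  have hp := (Fact.out : p.Prime)
  have hc := ordP_pos h0 h1
  have hp1 : (0 : ℝ) < (p : ℝ) - 1 := sub_pos.2 (by exact_mod_cast hp.one_lt)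
  -- Nonemptiness is needed for `sInf` to be attained rather than to take its default value `0`.
  have hne : {s : ℕ | 1 < (p : ℝ) ^ s * ((p : ℝ) - 1) * ordP p y}.Nonempty := by
    obtain ⟨s, hs⟩ := pow_unbounded_of_one_lt (1 / (((p : ℝ) - 1) * ordP p y))
      (by exact_mod_cast hp.one_lt : (1 : ℝ) < p)
    refine ⟨s, ?_⟩
    rw [div_lt_iff₀ (mul_pos hp1 hc), ← mul_assoc] at hs
    exact hs
  have h2 : 1 < (p : ℝ) ^ sInv p β * ((p : ℝ) - 1) * ordP p y := Nat.sInf_mem hne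
  rw [← norm_pow, ← one_lt_ordP_iff (pow_ne_zero _ h0), ordP_pow]
  push_cast [Nat.cast_sub hp.one_lt.le]
  exact h2

/-- Since `τ ^ n = 1`, the quantity is the distance of `u ^ n` to `1` for `u = β / τ`. The
prime-to-`p` part of `n` drops out, and each factor `p` beyond the first `min (ord_p n) s` adds
exactly `1` to the valuation. -/
lemma ordP_pow_sub_one {β : PadicAlgCl p} (hβ : ‖β‖ = 1) (hN : 0 < residueOrder p β)
    (hroot : ∀ n : ℕ, n ≠ 0 → β ^ n ≠ 1) {n : ℕ} (hn : n ≠ 0) (hdvd : residueOrder p β ∣ n) :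
    ordP p (β ^ n - 1) = padicValNat p n +
      (ordP p (β ^ p ^ min (padicValNat p n) (sInv p β) -
        teichmuller p (reduction p β) ^ p ^ min (padicValNat p n) (sInv p β)) -
          (min (padicValNat p n) (sInv p β) : ℕ)) := by
  set τ := teichmuller p (reduction p β) with hτdef
  set a := padicValNat p n with ha
  set s := sInv p β with hs
  have hp := (Fact.out : p.Prime)
  have hτ : ‖τ‖ = 1 := norm_teichmuller hN
  have hτ0 : τ ≠ 0 := fun h => by simp [h] at hτ
  have hτN : ∀ m, residueOrder p β ∣ m → τ ^ m = 1 := by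
    rintro _ ⟨m, rfl⟩
    rw [pow_mul, teichmuller_pow_residueOrder hN, one_pow]
  have hβτ : ‖β - τ‖ < 1 := by
    rw [norm_sub_rev, ← reduction_eq_iff hτ.le hβ.le]
    exact (teichmuller_spec hN).2
  -- Otherwise `β` would be a root of unity; at `0` the function `ordP` has only a default value.
  have hβτ0 : β - τ ≠ 0 := fun h =>
    hroot (residueOrder p β) hN.ne'
      ((congrArg (· ^ residueOrder p β) (sub_eq_zero.1 h)).trans (hτN (residueOrder p β) dvd_rfl))
  have hsub : ∀ m : ℕ, ‖β ^ m - τ ^ m‖ = ‖(β / τ) ^ m - 1‖ := by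
    intro m
    have h1 : β ^ m - τ ^ m = ((β / τ) ^ m - 1) * τ ^ m := by
      rw [div_pow, sub_mul, div_mul_cancel₀ _ (pow_ne_zero _ hτ0), one_mul]
    rw [h1, norm_mul, norm_pow, hτ, one_pow, mul_one]
  have hu : ‖β / τ - 1‖ = ‖β - τ‖ := by simpa using (hsub 1).symm
  have hu1 : ‖β / τ - 1‖ < 1 := hu ▸ hβτ
  obtain ⟨m, hm⟩ : p ^ a ∣ n := pow_padicValNat_dvd
  have hmp : m.Coprime p := by
    rw [Nat.coprime_comm, hp.coprime_iff_not_dvd]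
    rintro ⟨c, hc⟩
    refine pow_succ_padicValNat_not_dvd (p := p) hn ⟨c, ?_⟩
    rw [pow_succ, mul_assoc, ← hc]
    exact hm
  have h1 : ‖β ^ n - 1‖ = ‖(p : PadicAlgCl p) ^ (a - min a s) *
      (β ^ p ^ min a s - τ ^ p ^ min a s)‖ := by
    have h2 := hsub n
    rw [hτN n hdvd] at h2
    rw [h2, hm, pow_mul, IsUltrametricDist.norm_pow_sub_one_eq
      ((IsUltrametricDist.norm_pow_sub_one_le hu1 _).trans_lt hu1) (norm_natCast_eq_one hmp),
      IsUltrametricDist.norm_pow_prime_pow_sub_one hp hu1 (s := s), norm_mul, norm_pow, hsub]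
    rw [hu]
    exact sInv_spec hβτ0 hβτ
  have hp0 : (p : PadicAlgCl p) ≠ 0 := Nat.cast_ne_zero.2 hp.ne_zero
  have h3 : β ^ p ^ min a s - τ ^ p ^ min a s ≠ 0 := by
    intro h4
    rw [h4, mul_zero, norm_zero, norm_eq_zero, sub_eq_zero] at h1
    exact hroot n hn h1
  rw [ordP_congr h1, ordP_mul (pow_ne_zero _ hp0) h3, ordP_pow, ordP_natCast_p,
    Nat.cast_sub (min_le_left _ _)]
  ring

end IharaTower

namespace IharaTower

/-! ### The classes -/

/-- Both labels of a class are recovered from `n`, which is why the classes form a partition. -/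
lemma mem_divClass_iff {p : ℕ} {N S : Finset ℕ} {R r n : ℕ} (hS : S ⊆ N) (hr : r ≤ R) :
    n ∈ divClass p N R S r ↔
      1 ≤ n ∧ S = N.filter (· ∣ n) ∧ r = min (padicValNat p n) R := by
  constructor
  · rintro ⟨h1, h2, h3, h4, h5⟩
    refine ⟨h1, ?_, ?_⟩
    · ext d
      rw [Finset.mem_filter]
      exact ⟨fun hd => ⟨hS hd, h2 d hd⟩, fun hd => by_contra fun hd' =>
        h3 d (Finset.mem_sdiff.2 ⟨hd.1, hd'⟩) hd.2⟩
    · rcases hr.lt_or_eq with h | h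
      · rw [h4 h, min_eq_left hr]
      · rw [min_eq_right (h5 h), h]
  · rintro ⟨h1, h2, h3⟩
    refine ⟨h1, fun d hd => ?_, fun d hd hdn => ?_, fun h => ?_, fun h => ?_⟩
    · rw [h2] at hd
      exact (Finset.mem_filter.1 hd).2
    · rw [Finset.mem_sdiff] at hd
      exact hd.2 (h2 ▸ Finset.mem_filter.2 ⟨hd.1, hdn⟩)
    · omega
    · omega

lemma existsUnique_divClass (p : ℕ) (N : Finset ℕ) (R : ℕ) {n : ℕ} (hn : 1 ≤ n) :
    ∃! c : Finset ℕ × ℕ, c.1 ⊆ N ∧ c.2 ≤ R ∧ n ∈ divClass p N R c.1 c.2 := by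
  refine ⟨(N.filter (· ∣ n), min (padicValNat p n) R), ⟨Finset.filter_subset _ _, min_le_right _ _,
    (mem_divClass_iff (Finset.filter_subset _ _) (min_le_right _ _)).2 ⟨hn, rfl, rfl⟩⟩, ?_⟩
  rintro ⟨S, r⟩ ⟨hS, hr, h⟩
  obtain ⟨-, h1, h2⟩ := (mem_divClass_iff hS hr).1 h
  exact Prod.ext h1 h2

/-! ### The Mahler measure -/

lemma gaussNorm_X_sub_C {K : Type*} [NormedField K] (β : K) :
    (Polynomial.X - Polynomial.C β).gaussNorm (NormedField.toAbsoluteValue K) 1 = max 1 ‖β‖ := by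
  set v := NormedField.toAbsoluteValue K
  have hv : ∀ x : K, v x = ‖x‖ := fun _ => rfl
  refine le_antisymm ?_ (max_le ?_ ?_)
  · obtain ⟨i, hi⟩ := (Polynomial.X - Polynomial.C β).exists_eq_gaussNorm v 1
    rw [hi, one_pow, mul_one, hv, Polynomial.coeff_sub, Polynomial.coeff_X, Polynomial.coeff_C]
    split_ifs <;> simp_all
  · have h := (Polynomial.X - Polynomial.C β).le_gaussNorm v zero_le_one 1
    simpa [hv, Polynomial.coeff_X, Polynomial.coeff_C] using h
  · have h := (Polynomial.X - Polynomial.C β).le_gaussNorm v zero_le_one 0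
    simpa [hv, Polynomial.coeff_X, Polynomial.coeff_C] using h

/-- The nonarchimedean Mahler measure is the Gauss norm. -/
lemma gaussNorm_eq_mahler {K : Type*} [NormedField K] [IsUltrametricDist K] [IsAlgClosed K]
    (g : K[X]) : g.gaussNorm (NormedField.toAbsoluteValue K) 1 =
      ‖g.leadingCoeff‖ * (g.roots.map fun β => max 1 ‖β‖).prod := by
  have hna : IsNonarchimedean (NormedField.toAbsoluteValue K) := IsUltrametricDist.norm_add_le_max
  have key : ∀ m : Multiset K, (m.map fun β => Polynomial.X - Polynomial.C β).prod.gaussNorm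
      (NormedField.toAbsoluteValue K) 1 = (m.map fun β => max 1 ‖β‖).prod := by
    intro m
    induction m using Multiset.induction with
    | empty =>
      rw [Multiset.map_zero, Multiset.prod_zero, Multiset.map_zero, Multiset.prod_zero,
        ← Polynomial.C_1, Polynomial.gaussNorm_C]
      exact norm_one
    | cons β m ih =>
      rw [Multiset.map_cons, Multiset.prod_cons, Polynomial.gaussNorm_mul hna one_pos, ih,
        gaussNorm_X_sub_C, Multiset.map_cons, Multiset.prod_cons]
  conv_lhs => rw [(IsAlgClosed.splits g).eq_prod_roots]
  rw [Polynomial.gaussNorm_mul hna one_pos, key, Polynomial.gaussNorm_C]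
  rfl

variable {p : ℕ} [Fact p.Prime]

/-- All roots of an integer polynomial already lie in the algebraic closure of `ℚ_p`, and the norm
of `ℂ_p` extends the one there. -/
lemma padicMahler_map (f : ℤ[X]) : padicMahler p (f.map (Int.castRingHom ℂ_[p])) =
    ‖(f.leadingCoeff : PadicAlgCl p)‖ * ((f.aroots (PadicAlgCl p)).map fun β => max 1 ‖β‖).prod := by
  have h : f.map (Int.castRingHom ℂ_[p]) =
      (f.map (algebraMap ℤ (PadicAlgCl p))).map (algebraMap (PadicAlgCl p) ℂ_[p]) := by
    rw [Polynomial.map_map]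
    congr 1
    exact RingHom.ext_int _ _
  have hn : ∀ x : PadicAlgCl p, ‖algebraMap (PadicAlgCl p) ℂ_[p] x‖ = ‖x‖ :=
    PadicComplex.norm_extends p
  rw [padicMahler, h, Polynomial.leadingCoeff_map, hn,
    Polynomial.leadingCoeff_map_of_injective (RingHom.injective_int _),
    (IsAlgClosed.splits (f.map (algebraMap ℤ (PadicAlgCl p)))).roots_map, Multiset.map_map]
  simp only [Function.comp_apply, hn]
  rfl

lemma padicMahler_mul {g h : (ℂ_[p])[X]} (hg : g ≠ 0) (hh : h ≠ 0) :
    padicMahler p (g * h) = padicMahler p g * padicMahler p h := by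
  rw [padicMahler, Polynomial.roots_mul (mul_ne_zero hg hh), Polynomial.leadingCoeff_mul, norm_mul,
    Multiset.map_add, Multiset.prod_add, padicMahler, padicMahler]
  ring

/-- The factor `(t - 1) ^ e` has Mahler measure `1`, so `μ_p` can be computed from `J`. -/
lemma padicMahler_clearedPoly {F : ℤ[T;T⁻¹]} (hF : F ≠ 0) :
    padicMahler p ((clearedPoly F).map (Int.castRingHom ℂ_[p])) =
      ‖((jPoly F).leadingCoeff : PadicAlgCl p)‖ *
        (((jPoly F).aroots (PadicAlgCl p)).map fun β => max 1 ‖β‖).prod := by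
  have hinj := RingHom.injective_int (Int.castRingHom ℂ_[p])
  rw [← pow_mul_jPoly, Polynomial.map_mul, padicMahler_mul, padicMahler_map (jPoly F)]
  · have h1 : padicMahler p (((Polynomial.X - Polynomial.C (1 : ℤ)) ^ ordOne F).map
        (Int.castRingHom ℂ_[p])) = 1 := by
      rw [Polynomial.map_pow, Polynomial.map_sub, Polynomial.map_X, Polynomial.map_C, map_one,
        padicMahler, Polynomial.roots_pow, Polynomial.roots_X_sub_C, Polynomial.leadingCoeff_pow,
        Polynomial.leadingCoeff_X_sub_C, Multiset.map_nsmul, Multiset.prod_nsmul]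
      simp
    rw [h1, one_mul]
  · rw [Polynomial.map_ne_zero_iff hinj]
    exact pow_ne_zero _ (Polynomial.X_sub_C_ne_zero _)
  · rw [Polynomial.map_ne_zero_iff hinj]
    exact jPoly_ne_zero hF

lemma norm_intCast_eq {z : ℤ} (hz : z ≠ 0) :
    ‖(z : PadicAlgCl p)‖ = (p : ℝ) ^ (-(padicValInt p z : ℤ)) := by
  have h1 : ((z : ℚ) : ℚ_[p]) = (z : ℚ_[p]) := by norm_cast
  rw [norm_intCast, ← h1, Padic.eq_padicNorm, padicNorm.eq_zpow_of_nonzero (by exact_mod_cast hz),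
    padicValRat.of_int]
  push_cast
  rfl

lemma ordP_intCast {z : ℤ} (hz : z ≠ 0) : ordP p (z : PadicAlgCl p) = padicValInt p z := by
  rw [ordP, norm_intCast_eq hz, Real.log_zpow]
  have := (log_p_pos (p := p)).ne'
  push_cast
  field_simp

lemma ordP_natCast {n : ℕ} (hn : n ≠ 0) : ordP p (n : PadicAlgCl p) = padicValNat p n := by
  have := ordP_intCast (p := p) (z := n) (by exact_mod_cast hn)
  simpa using this

/-- The invariant `μ_p` is an integer. -/
lemma muInv_mem_range {F : ℤ[T;T⁻¹]} (hF : F ≠ 0) : muInv p F ∈ (Int.castAddHom ℝ).range := by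
  have h1 := gaussNorm_eq_mahler ((jPoly F).map (algebraMap ℤ (PadicAlgCl p)))
  obtain ⟨i, hi⟩ := ((jPoly F).map (algebraMap ℤ (PadicAlgCl p))).exists_eq_gaussNorm
    (NormedField.toAbsoluteValue (PadicAlgCl p)) 1
  -- The Gauss norm is attained at a coefficient of `J`, which is an ordinary integer.
  have h2 : padicMahler p ((clearedPoly F).map (Int.castRingHom ℂ_[p])) =
      ‖((jPoly F).coeff i : PadicAlgCl p)‖ := by
    rw [padicMahler_clearedPoly hF]
    rw [Polynomial.leadingCoeff_map_of_injective (RingHom.injective_int _), hi, one_pow, mul_one,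
      Polynomial.coeff_map] at h1
    exact h1.symm
  rw [muInv, h2]
  change ordP p ((jPoly F).coeff i : PadicAlgCl p) ∈ _
  by_cases h0 : (jPoly F).coeff i = 0
  · exact ⟨0, by simp [h0, ordP]⟩
  · rw [ordP_intCast h0]
    exact ⟨padicValInt p ((jPoly F).coeff i), by simp⟩

/-! ### The valuation of the Pierce-Lehmer sequence -/

lemma log_multiset_prod {ι : Type*} (m : Multiset ι) (g : ι → ℝ) (hg : ∀ x ∈ m, g x ≠ 0) :
    Real.log (m.map g).prod = (m.map fun x => Real.log (g x)).sum := by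
  induction m using Multiset.induction with
  | empty => simp
  | cons a m ih =>
    have h1 : (m.map g).prod ≠ 0 := by
      rw [Ne, Multiset.prod_eq_zero_iff, Multiset.mem_map]
      rintro ⟨x, hx, h0⟩
      exact hg x (Multiset.mem_cons_of_mem hx) h0
    rw [Multiset.map_cons, Multiset.prod_cons, Real.log_mul (hg a (Multiset.mem_cons_self a m)) h1,
      ih fun x hx => hg x (Multiset.mem_cons_of_mem hx), Multiset.map_cons, Multiset.sum_cons]

lemma sum_map_filter_eq_sum_ite {ι M : Type*} [AddCommMonoid M] (m : Multiset ι) (q : ι → Prop)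
    [DecidablePred q] (g : ι → M) :
    ((m.filter q).map g).sum = (m.map fun x => if q x then g x else 0).sum := by
  induction m using Multiset.induction with
  | empty => simp
  | cons a m ih =>
    rw [Multiset.map_cons, Multiset.sum_cons, ← ih]
    by_cases h : q a
    · rw [Multiset.filter_cons_of_pos _ h, Multiset.map_cons, Multiset.sum_cons, if_pos h]
    · rw [Multiset.filter_cons_of_neg _ h, if_neg h, zero_add]

variable (p) in
/-- The elements of `orderSet` that divide `n`. -/
def orderSetDvd (f : ℤ[X]) (n : ℕ) : Finset ℕ := (orderSet p f).filter (· ∣ n)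

lemma residueOrder_mem_orderSet {f : ℤ[X]} {β : PadicAlgCl p} (h : β ∈ unitRoots p f) :
    residueOrder p β ∈ orderSet p f := by
  rw [orderSet, Multiset.mem_toFinset]
  exact Multiset.mem_map_of_mem _ h

lemma mem_unitRoots {f : ℤ[X]} {β : PadicAlgCl p} :
    β ∈ unitRoots p f ↔ β ∈ f.aroots (PadicAlgCl p) ∧ ‖β‖ = 1 := by
  rw [unitRoots, Multiset.mem_filter]

lemma unitRootsIn_orderSetDvd (f : ℤ[X]) (n : ℕ) : unitRootsIn p f (orderSetDvd p f n) =
    (unitRoots p f).filter fun β => residueOrder p β ∣ n := by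
  classical
  refine (Multiset.filter_congr (q := fun β => residueOrder p β ∣ n) fun β hβ => ?_).trans ?_
  · rw [orderSetDvd, Finset.mem_filter]
    exact and_iff_right (residueOrder_mem_orderSet hβ)
  · convert rfl

/-- By the ultrametric inequality `|β^n - 1|` is `1` for `|β| < 1` and `|β|^n` for `|β| > 1`. On the
unit circle only the roots whose residue order divides `n` contribute. -/
lemma log_prod_pow_sub_one (f : ℤ[X]) {n : ℕ} (hn : n ≠ 0)
    (hroot : ∀ β ∈ f.aroots (PadicAlgCl p), β ^ n ≠ 1) :
    Real.log ((f.aroots (PadicAlgCl p)).map fun β => ‖β ^ n - 1‖).prod =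
      n * Real.log ((f.aroots (PadicAlgCl p)).map fun β => max 1 ‖β‖).prod +
        ((unitRootsIn p f (orderSetDvd p f n)).map fun β => Real.log ‖β ^ n - 1‖).sum := by
  classical
  have hmax : ∀ β : PadicAlgCl p, max 1 ‖β‖ ≠ 0 := fun β =>
    (lt_of_lt_of_le one_pos (le_max_left 1 ‖β‖)).ne'
  rw [log_multiset_prod _ _ fun β hβ => norm_ne_zero_iff.2 (sub_ne_zero.2 (hroot β hβ)),
    log_multiset_prod _ _ fun β _ => hmax β, unitRootsIn_orderSetDvd, unitRoots,
    Multiset.filter_filter, ← Multiset.sum_map_mul_left, sum_map_filter_eq_sum_ite,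
    ← Multiset.sum_map_add]
  refine congrArg _ (Multiset.map_congr rfl fun β hβ => ?_)
  rcases lt_trichotomy ‖β‖ 1 with h | h | h
  · have h1 : ‖β ^ n‖ < 1 := by rw [norm_pow]; exact pow_lt_one₀ (norm_nonneg _) h hn
    have h2 : ‖β ^ n - 1‖ = 1 := by
      rw [norm_sub_rev]
      have := IsUltrametricDist.norm_eq_one_of_sub_one_lt (u := 1 - β ^ n) (by simpa using h1)
      exact this
    rw [if_neg (fun h3 => h.ne h3.2), h2, max_eq_left h.le]
    simp
  · rw [h, max_self, Real.log_one, mul_zero, zero_add]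
    split_ifs with h1
    · rfl
    · rw [norm_pow_sub_one_of_not_dvd h fun h2 => h1 ⟨h2, rfl⟩, Real.log_one]
  · have h1 : 1 < ‖β ^ n‖ := by rw [norm_pow]; exact one_lt_pow₀ h hn
    have h2 : ‖β ^ n - 1‖ = ‖β ^ n‖ := by
      have := IsUltrametricDist.norm_add_eq_max_of_norm_ne_norm (x := β ^ n) (y := -1)
        (by rw [norm_neg, norm_one]; exact h1.ne')
      rwa [← sub_eq_add_neg, norm_neg, norm_one, max_eq_left h1.le] at this
    rw [if_neg (fun h3 => h.ne' h3.2), h2, max_eq_right h.le, norm_pow, Real.log_pow, add_zero]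

/-- The sum of the valuations of the `β ^ n - 1`. -/
lemma sum_ordP_pow_sub_one {f : ℤ[X]} (hf : f ≠ 0) {n : ℕ} (hn : n ≠ 0)
    (hroot : ∀ β ∈ f.aroots (PadicAlgCl p), ∀ n : ℕ, n ≠ 0 → β ^ n ≠ 1) :
    ((unitRootsIn p f (orderSetDvd p f n)).map fun β => ordP p (β ^ n - 1)).sum =
      (unitRootsIn p f (orderSetDvd p f n)).card * padicValNat p n +
        unitRootSum p f (orderSetDvd p f n) (padicValNat p n) := by
  have hcard : ((unitRootsIn p f (orderSetDvd p f n)).card * padicValNat p n : ℝ) =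
      ((unitRootsIn p f (orderSetDvd p f n)).map fun _ => (padicValNat p n : ℝ)).sum := by simp
  rw [unitRootSum, hcard, ← Multiset.sum_map_add]
  refine congrArg _ (Multiset.map_congr rfl fun β hβ => ?_)
  rw [unitRootsIn_orderSetDvd, Multiset.mem_filter, mem_unitRoots] at hβ
  obtain ⟨⟨h1, h2⟩, h3⟩ := hβ
  exact ordP_pow_sub_one h2 (residueOrder_pos hf h2 ((Polynomial.mem_aroots.1 h1).2))
    (hroot β h1) hn h3

/-! ### Integrality of the contribution of the unit roots -/

lemma unitRootSum_insert (f : ℤ[X]) {d : ℕ} {S : Finset ℕ} (hd : d ∉ S) (r : ℕ) :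
    unitRootSum p f (insert d S) r = unitRootSum p f {d} r + unitRootSum p f S r := by
  have h : unitRootsIn p f (insert d S) = unitRootsIn p f {d} + unitRootsIn p f S := by
    classical
    rw [unitRootsIn, unitRootsIn, unitRootsIn, Multiset.filter_add_filter]
    have h1 : (unitRoots p f).filter (fun β => residueOrder p β ∈ ({d} : Finset ℕ) ∧
        residueOrder p β ∈ S) = 0 := by
      rw [Multiset.filter_eq_nil]
      rintro β - ⟨h1, h2⟩
      rw [Finset.mem_singleton] at h1
      exact hd (h1 ▸ h2)
    rw [h1, add_zero]
    refine Multiset.filter_congr fun β _ => ?_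
    rw [Finset.mem_insert, Finset.mem_singleton]
  rw [unitRootSum, h, Multiset.map_add, Multiset.sum_add]
  rfl

lemma unitRootSum_eq_sum (f : ℤ[X]) (S : Finset ℕ) (r : ℕ) :
    unitRootSum p f S r = ∑ d ∈ S, unitRootSum p f {d} r := by
  induction S using Finset.induction with
  | empty => simp [unitRootSum, unitRootsIn]
  | insert d S hd ih => rw [unitRootSum_insert f hd, ih, Finset.sum_insert hd]

/-- Only the sets `orderSetDvd p f n` come from an actual `n`, so the sum is split into singletons.
For `n = d p^r` the set consists of `d` and proper divisors of `d`, because all orders are prime to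
`p`; strong induction on `d` isolates the term of `d`. -/
lemma unitRootSum_mem_range {f : ℤ[X]} (hcop : ∀ d ∈ orderSet p f, d.Coprime p)
    (h : ∀ n, n ≠ 0 → unitRootSum p f (orderSetDvd p f n) (padicValNat p n) ∈
      (Int.castAddHom ℝ).range) {S : Finset ℕ} (hS : S ⊆ orderSet p f) (r : ℕ) :
    unitRootSum p f S r ∈ (Int.castAddHom ℝ).range := by
  have key : ∀ d, d ∈ orderSet p f → unitRootSum p f {d} r ∈ (Int.castAddHom ℝ).range := by
    intro d
    induction d using Nat.strong_induction_on with
    | _ d ih =>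
      intro hd
      have hd0 := ne_zero_of_coprime (hcop d hd)
      have hp := (Fact.out : p.Prime)
      have hval : padicValNat p (d * p ^ r) = r := by
        rw [padicValNat.mul hd0 (pow_ne_zero _ hp.ne_zero), padicValNat.prime_pow,
          padicValNat.eq_zero_of_not_dvd, zero_add]
        exact (hp.coprime_iff_not_dvd).1 (hcop d hd).symm
      have h1 := h (d * p ^ r) (mul_ne_zero hd0 (pow_ne_zero _ hp.ne_zero))
      have hmem : d ∈ orderSetDvd p f (d * p ^ r) :=
        Finset.mem_filter.2 ⟨hd, dvd_mul_right _ _⟩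
      rw [hval, unitRootSum_eq_sum, ← Finset.add_sum_erase _ _ hmem] at h1
      refine (AddSubgroup.add_mem_cancel_right _ (sum_mem fun d' hd' => ?_)).1 h1
      rw [Finset.mem_erase, orderSetDvd, Finset.mem_filter] at hd'
      obtain ⟨hne, hd'1, hd'2⟩ := hd'
      have hdvd : d' ∣ d := ((hcop d' hd'1).pow_right r).dvd_of_dvd_mul_right hd'2
      exact ih d' (lt_of_le_of_ne (Nat.le_of_dvd (Nat.pos_of_ne_zero hd0) hdvd) hne) hd'1
  rw [unitRootSum_eq_sum]
  exact sum_mem fun d hd => key d (hS hd)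

lemma unitRootSum_min_levelBound (f : ℤ[X]) (S : Finset ℕ) (a : ℕ) :
    unitRootSum p f S (min a (levelBound p f)) = unitRootSum p f S a := by
  rw [unitRootSum, unitRootSum]
  refine congrArg _ (Multiset.map_congr rfl fun β hβ => ?_)
  have h : sInv p β ≤ levelBound p f :=
    Multiset.le_sup (Multiset.mem_map_of_mem _ (Multiset.mem_filter.1 hβ).1)
  rw [min_assoc, min_eq_right h]

end IharaTower

/-! ### The valuation formula for a single layer -/

open IharaTower in
/-- The valuation of the number of spanning trees of the `n`-th layer. -/
theorem SerreGraph.padicValNat_kappa_layer {V E : Type*} [Fintype V] [DecidableEq V] [Fintype E]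
    [Nonempty V] (X : SerreGraph V E) (hX : X.Connected)
    (α : X.Voltage ℤ) (hα : ∀ n : ℕ, 1 ≤ n → (X.layer α n).Connected)
    (p : ℕ) [Fact p.Prime] {n : ℕ} (hn : n ≠ 0) :
    (padicValNat p (X.layer α n).kappa : ℝ) = muInv p (X.iharaPoly α) * n +
      ((unitRootsIn p (jPoly (X.iharaPoly α)) (orderSetDvd p (jPoly (X.iharaPoly α)) n)).card +
        ordOne (X.iharaPoly α) - 1) * padicValNat p n +
      ((padicValNat p X.kappa : ℝ) - padicValInt p (pierceLehmer (jPoly (X.iharaPoly α)) 1) +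
        unitRootSum p (jPoly (X.iharaPoly α)) (orderSetDvd p (jPoly (X.iharaPoly α)) n)
          (padicValNat p n)) := by
  have hF := X.iharaPoly_ne_zero α hα
  set F := X.iharaPoly α
  set J := jPoly F
  have hkn : ∀ n : ℕ, n ≠ 0 → (X.layer α n).kappa ≠ 0 := fun n hn => by
    have : NeZero n := ⟨hn⟩
    exact kappa_ne_zero _ (hα n (Nat.one_le_iff_ne_zero.2 hn))
  have hk := X.kappa_ne_zero hX
  have hJ1 : J.eval 1 ≠ 0 := eval_one_jPoly_ne_zero hF
  have hnorm : ∀ n : ℕ, n ≠ 0 →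
      ‖(n : PadicAlgCl p)‖ * ‖((X.layer α n).kappa : PadicAlgCl p)‖ *
        ‖((J.eval 1 : ℤ) : PadicAlgCl p)‖ = ‖(X.kappa : PadicAlgCl p)‖ *
        ‖(n : PadicAlgCl p)‖ ^ ordOne F * (‖(J.leadingCoeff : PadicAlgCl p)‖ ^ n *
          ((J.aroots (PadicAlgCl p)).map fun β => ‖β ^ n - 1‖).prod) := fun n hn => by
    have : NeZero n := ⟨hn⟩
    rw [Polynomial.aroots_def, RingHom.ext_int (algebraMap ℤ (PadicAlgCl p))
      (Int.castRingHom (PadicAlgCl p))]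
    exact norm_kappa_layer X α n
  -- If `β ^ n = 1`, the right-hand side of the norm identity vanishes, while connectedness of `X_n`
  -- and `J(1) ≠ 0` keep the left-hand side nonzero.
  have hroot : ∀ β ∈ J.aroots (PadicAlgCl p), ∀ n : ℕ, n ≠ 0 → β ^ n ≠ 1 := by
    intro β hβ n hn h
    have h1 := hnorm n hn
    have h0 : ((J.aroots (PadicAlgCl p)).map fun β => ‖β ^ n - 1‖).prod = 0 := by
      rw [Multiset.prod_eq_zero_iff, Multiset.mem_map]
      exact ⟨β, hβ, by rw [h, sub_self, norm_zero]⟩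
    rw [h0, mul_zero, mul_zero] at h1
    simp only [mul_eq_zero, norm_eq_zero, Nat.cast_eq_zero, Int.cast_eq_zero] at h1
    rcases h1 with (h1 | h1) | h1
    · exact hn h1
    · exact hkn n hn h1
    · exact hJ1 h1
  have hlc : (J.leadingCoeff : PadicAlgCl p) ≠ 0 :=
    Int.cast_ne_zero.2 (Polynomial.leadingCoeff_ne_zero.2 (jPoly_ne_zero hF))
  have hprod : ((J.aroots (PadicAlgCl p)).map fun β => ‖β ^ n - 1‖).prod ≠ 0 := by
    rw [Ne, Multiset.prod_eq_zero_iff, Multiset.mem_map]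
    rintro ⟨β, hβ, h0⟩
    exact hroot β hβ n hn (sub_eq_zero.1 (norm_eq_zero.1 h0))
  have hmax : ((J.aroots (PadicAlgCl p)).map fun β => max 1 ‖β‖).prod ≠ 0 := by
    rw [Ne, Multiset.prod_eq_zero_iff, Multiset.mem_map]
    rintro ⟨β, -, h0⟩
    exact (lt_of_lt_of_le one_pos (le_max_left 1 ‖β‖)).ne' h0
  have hn' : ‖(n : PadicAlgCl p)‖ ≠ 0 := norm_ne_zero_iff.2 (Nat.cast_ne_zero.2 hn)
  have hkn' : ‖((X.layer α n).kappa : PadicAlgCl p)‖ ≠ 0 :=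
    norm_ne_zero_iff.2 (Nat.cast_ne_zero.2 (hkn n hn))
  have hk' : ‖(X.kappa : PadicAlgCl p)‖ ≠ 0 := norm_ne_zero_iff.2 (Nat.cast_ne_zero.2 hk)
  have hJ1' : ‖((J.eval 1 : ℤ) : PadicAlgCl p)‖ ≠ 0 := norm_ne_zero_iff.2 (Int.cast_ne_zero.2 hJ1)
  have hlc' := norm_ne_zero_iff.2 hlc
  have h1 := congrArg Real.log (hnorm n hn)
  rw [Real.log_mul (mul_ne_zero hn' hkn') hJ1', Real.log_mul hn' hkn',
    Real.log_mul (mul_ne_zero hk' (pow_ne_zero _ hn')) (mul_ne_zero (pow_ne_zero _ hlc') hprod),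
    Real.log_mul hk' (pow_ne_zero _ hn'), Real.log_mul (pow_ne_zero _ hlc') hprod, Real.log_pow,
    Real.log_pow, log_prod_pow_sub_one J hn fun β hβ => hroot β hβ n hn] at h1
  have hlogp := (log_p_pos (p := p)).ne'
  have hord : ∀ x : PadicAlgCl p, Real.log ‖x‖ = - (Real.log p) * ordP p x := by
    intro x
    rw [ordP]
    field_simp
  -- The leading coefficient and the roots outside the unit disc combine into the coefficient of
  -- `n`.
  have hmu : Real.log ‖(J.leadingCoeff : PadicAlgCl p)‖ +
      Real.log ((J.aroots (PadicAlgCl p)).map fun β => max 1 ‖β‖).prod =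
        - (Real.log p) * muInv p F := by
    rw [muInv, padicMahler_clearedPoly hF, Real.log_mul hlc' hmax]
    field_simp
  have hsum : ((unitRootsIn p J (orderSetDvd p J n)).map fun β => Real.log ‖β ^ n - 1‖).sum =
      - (Real.log p) * ((unitRootsIn p J (orderSetDvd p J n)).map fun β => ordP p (β ^ n - 1)).sum := by
    rw [← Multiset.sum_map_mul_left]
    exact congrArg _ (Multiset.map_congr rfl fun β _ => hord _)
  have hPL : padicValInt p (pierceLehmer J 1) = padicValInt p (J.eval 1) := by
    rw [padicValInt, padicValInt, Int.natAbs_eq_natAbs_iff.2 (abs_eq_abs.1 (pierceLehmer_one J))]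
  rw [hsum, sum_ordP_pow_sub_one (jPoly_ne_zero hF) hn hroot, hord, hord, hord, hord,
    ordP_natCast hn, ordP_natCast (hkn n hn), ordP_natCast hk, ordP_intCast hJ1] at h1
  rw [hPL]
  have h2 : - (Real.log p) ≠ 0 := neg_ne_zero.2 hlogp
  refine mul_left_cancel₀ h2 ?_
  linear_combination h1 + n * hmu

end

/-! ### Integrality of `ν_p` and the final formula -/

open scoped LaurentPolynomial Polynomial

theorem mainTheorem4 {V E : Type*} [Fintype V] [DecidableEq V] [Fintype E]
    (X : SerreGraph V E) (hX : X.Connected) (hχ : X.eulerChar ≠ 0)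
    (α : X.Voltage ℤ) (hα : ∀ n : ℕ, 1 ≤ n → (X.layer α n).Connected)
    (p : ℕ) [Fact p.Prime] :
    ∃ (N : Finset ℕ) (R : ℕ) (lam : Finset ℕ → ℤ) (nu : Finset ℕ → ℕ → ℤ),
      -- `N` consists of integers coprime to `p`
      (∀ d ∈ N, d.Coprime p) ∧
      -- the classes partition the positive integers
      (∀ n : ℕ, 1 ≤ n → ∃! c : Finset ℕ × ℕ,
        c.1 ⊆ N ∧ c.2 ≤ R ∧ n ∈ IharaTower.divClass p N R c.1 c.2) ∧
      -- the formula on each class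
      (∀ S ⊆ N, 0 ≤ lam S) ∧
      (∀ S ⊆ N, ∀ r ≤ R, ∀ n ∈ IharaTower.divClass p N R S r,
        (padicValNat p (X.layer α n).kappa : ℝ) =
          IharaTower.muInv p (X.iharaPoly α) * n + lam S * padicValNat p n + nu S r) ∧
      -- the explicit values of all the invariants
      N = IharaTower.orderSet p (IharaTower.jPoly (X.iharaPoly α)) ∧
      R = IharaTower.levelBound p (IharaTower.jPoly (X.iharaPoly α)) ∧
      (∀ S ⊆ N, lam S =
        (IharaTower.unitRootsIn p (IharaTower.jPoly (X.iharaPoly α)) S).card +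
          IharaTower.ordOne (X.iharaPoly α) - 1) ∧
      (∀ S ⊆ N, ∀ r ≤ R, (nu S r : ℝ) =
        (padicValNat p X.kappa : ℝ) -
          padicValInt p (IharaTower.pierceLehmer (IharaTower.jPoly (X.iharaPoly α)) 1) +
          IharaTower.unitRootSum p (IharaTower.jPoly (X.iharaPoly α)) S r) := by
  classical
  -- The empty graph has Euler characteristic `0`.
  have hV : Nonempty V := by
    by_contra h
    rw [not_nonempty_iff] at h
    have hE : IsEmpty E := ⟨fun e => h.false (X.o e)⟩
    exact hχ (by simp [SerreGraph.eulerChar])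
  have hF := X.iharaPoly_ne_zero α hα
  have hformula := fun {n : ℕ} (hn : n ≠ 0) => X.padicValNat_kappa_layer hX α hα p hn
  have hpos := X.ordOne_pos α hF
  set F := X.iharaPoly α
  set J := IharaTower.jPoly F
  have hcop : ∀ d ∈ IharaTower.orderSet p J, d.Coprime p := by
    intro d hd
    rw [IharaTower.orderSet, Multiset.mem_toFinset, Multiset.mem_map] at hd
    obtain ⟨β, hβ, rfl⟩ := hd
    rw [IharaTower.mem_unitRoots] at hβ
    exact IharaTower.residueOrder_coprime (IharaTower.residueOrder_pos
      (IharaTower.jPoly_ne_zero hF) hβ.2 (Polynomial.mem_aroots.1 hβ.1).2)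
  have hint : ∀ z : ℤ, (z : ℝ) ∈ (Int.castAddHom ℝ).range := fun z => ⟨z, rfl⟩
  have hmem : ∀ S ⊆ IharaTower.orderSet p J, ∀ r,
      ((padicValNat p X.kappa : ℝ) - padicValInt p (IharaTower.pierceLehmer J 1) +
        IharaTower.unitRootSum p J S r) ∈ (Int.castAddHom ℝ).range := by
    intro S hS r
    refine add_mem (sub_mem (hint (padicValNat p X.kappa)) (hint (padicValInt p _))) ?_
    refine IharaTower.unitRootSum_mem_range hcop (fun n hn => ?_) hS r
    -- Solve the formula for `n` for the contribution of the unit roots: all the other terms are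
    -- integers.
    have h1 : IharaTower.unitRootSum p J (IharaTower.orderSetDvd p J n) (padicValNat p n) =
        ((padicValNat p (X.layer α n).kappa : ℤ) : ℝ) - (n : ℕ) • IharaTower.muInv p F -
          ((((IharaTower.unitRootsIn p J (IharaTower.orderSetDvd p J n)).card +
            IharaTower.ordOne F - 1) * padicValNat p n + padicValNat p X.kappa -
              padicValInt p (IharaTower.pierceLehmer J 1) : ℤ) : ℝ) := by
      simp only [Int.cast_sub, Int.cast_add, Int.cast_mul, Int.cast_natCast, Int.cast_one]
      rw [hformula hn, nsmul_eq_mul]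
      ring
    rw [h1]
    exact sub_mem (sub_mem (hint _) (nsmul_mem (IharaTower.muInv_mem_range hF) _)) (hint _)
  -- The floor is merely a way to name the integer `ν_p`; by integrality it changes nothing.
  have hnu : ∀ S ⊆ IharaTower.orderSet p J, ∀ r,
      ((⌊(padicValNat p X.kappa : ℝ) - padicValInt p (IharaTower.pierceLehmer J 1) +
        IharaTower.unitRootSum p J S r⌋ : ℤ) : ℝ) =
      (padicValNat p X.kappa : ℝ) - padicValInt p (IharaTower.pierceLehmer J 1) +
        IharaTower.unitRootSum p J S r := by
    intro S hS r
    obtain ⟨z, hz⟩ := hmem S hS r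
    rw [← hz]
    exact congrArg _ (Int.floor_intCast z)
  refine ⟨IharaTower.orderSet p J, IharaTower.levelBound p J,
    fun S => (IharaTower.unitRootsIn p J S).card + IharaTower.ordOne F - 1,
    fun S r => ⌊(padicValNat p X.kappa : ℝ) - padicValInt p (IharaTower.pierceLehmer J 1) +
      IharaTower.unitRootSum p J S r⌋, hcop,
    fun n hn => IharaTower.existsUnique_divClass p _ _ hn, fun S _ => by dsimp only; omega, ?_, rfl, rfl,
    fun S _ => rfl, fun S hS r _ => hnu S hS r⟩
  intro S hS r hr n hn
  obtain ⟨hn1, hSn, hrn⟩ := (IharaTower.mem_divClass_iff hS hr).1 hn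
  have hSn : S = IharaTower.orderSetDvd p J n := hSn
  -- The class fixes only `r = min (ord_p n) R`. This suffices because every `s_j` is at most `R`,
  -- so capping at `R` does not change `min (ord_p n) s_j`.
  rw [hnu S hS r, hformula (Nat.one_le_iff_ne_zero.1 hn1), hrn,
    IharaTower.unitRootSum_min_levelBound, hSn]
  simp only [Int.cast_sub, Int.cast_add, Int.cast_natCast, Int.cast_one]
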